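/- Let $X_0=(V_0,E_0)$ be a finite connected graph (loops and multiple edges allowed), where $E_0$ is the set of directed edges, and let $e_1,\dots,e_N$ be an orientation of $X_0$, i.e. a choice of one directed edge out of each pair $e,\overline e$. Let $\kappa(X_0)$ be the number of spanning trees of $X_0$, and let $\mathbf Q(X_0)\subset P^{N-1}(\mathbb C)$ be the set of all points $[z_1,\dots,z_N]$ with $z_1^2+\cdots+z_N^2=0$ and $\sum_{i:\,t(e_i)=x}z_i=\sum_{i:\,o(e_i)=x}z_i$ for every $x\in V_0$. Let $L$ be a free abelian group of rank $2$. A topological crystal over $X_0$ with group $L$ is a connected covering graph $X\to X_0$ on which $L$ acts by covering transformations, simply transitively on the fibres; its vanishing subgroup $H\subset H_1(X_0,\mathbb Z)$ is the image of $H_1(X,\mathbb Z)$, equivalently the kernel of the canonical homomorphism $H_1(X_0,\mathbb Z)\to L$. Put $I(H)=\det(\alpha_i\cdot\alpha_j)$, where $(\alpha_i)$ is a $\mathbb Z$-basis of $H$ and $\cdot$ is the bilinear form on $1$-chains for which $e_1,\dots,e_N$ are orthonormal. A standard realization of $X$ is a map $\varPhi$ from the vertices of $X$ to $\mathbb C=\mathbb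 R^2$ (extended linearly to the edges) such that $\varPhi(\sigma x)=\varPhi(x)+\rho(\sigma)$ $(\sigma\in L)$ for some injective homomorphism $\rho:L\to\mathbb C$ whose image is a lattice, and such that the building cochain $\mathbf z(e)=\varPhi(t(e))-\varPhi(o(e))$, regarded as a cochain on $X_0$, is harmonic, i.e. $\sum_{e\in E_0,\,o(e)=x}\mathbf z(e)=0$ for all $x\in V_0$, and satisfies the tight-frame condition $\sum_{e\in E_0}\langle \mathbf x,\mathbf z(e)\rangle\mathbf z(e)=c\,\mathbf x$ $(\mathbf x\in\mathbb R^2)$ for some $c>0$. (1) Let $\mathbf z$ be the building cochain of a standard realization of a topological crystal over $X_0$ with group $L$ and vanishing subgroup $H$, and put $z_i=\mathbf z(e_i)$. Then $[z_1,\dots,z_N]$ is a point of $\mathbf Q(X_0)$, and for a positive square-free integer $D$ this point lies in $P^{N-1}\big(\mathbb Q(\sqrt{-D})\big)$ if and only if $D$ is the square-free part of the positive integer $\kappa(X_0)I(H)$. (2) Let $D$ be a positive square-free integer. Every point of $\mathbf Q(X_0)\cap P^{N-1}\big(\mathbb Q(\sqrt{-D})\big)$ is the point $[z_1,\dots,z_N]$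 given by a standard realization of some topological crystal over $X_0$ with group $L$, and $D$ is the square-free part of $\kappa(X_0)I(H)$, where $H$ is the vanishing subgroup of that crystal. -/

import Mathlib

open scoped LinearAlgebra.Projectivization

universe u v w

/-- A graph with a chosen orientation (loops and multiple edges are allowed). `V` is the set of
vertices and `A` the orientation: it contains exactly one of the two directed edges `e`, `ē`
carried by each edge. The set `E` of all directed edges is therefore `{e, ē | e ∈ A}`. -/
structure OrientedGraph (V A : Type*) where
  /-- origin -/
  o : A → V
  /-- terminus -/
  t : A → V

namespace OrientedGraph

section Basic

variable {V A : Type*} (X : OrientedGraph V A)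

/-- The subgraph with all vertices of `X` and with edge set `T` is connected; edges may be
traversed in both directions. -/
def ConnectedOn (T : Set A) : Prop :=
  Nonempty V ∧ ∀ x y : V, Relation.EqvGen (fun u v => ∃ e ∈ T, X.o e = u ∧ X.t e = v) x y

/-- `X` is connected. -/
def Connected : Prop := X.ConnectedOn Set.univ

/-- The boundary operator `∂ : C₁(X, ℤ) → C₀(X, ℤ)`, `∂ e = t(e) - o(e)`; integral 1-chains are
finite formal sums of edges of the orientation (with `ē = -e`). -/
noncomputable def boundary : (A →₀ ℤ) →ₗ[ℤ] (V →₀ ℤ) :=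
  Finsupp.lmapDomain ℤ ℤ X.t - Finsupp.lmapDomain ℤ ℤ X.o

/-- The homology group `H₁(X, ℤ) = Ker ∂`. -/
noncomputable def H1 : Submodule ℤ (A →₀ ℤ) := LinearMap.ker X.boundary

/-- A set of edges is a spanning tree if, together with all the vertices, it forms a connected
graph without cycles (there is no nonzero 1-cycle supported on it). -/
def IsSpanningTree (T : Finset A) : Prop :=
  X.ConnectedOn (T : Set A) ∧ ∀ c ∈ X.H1, c.support ⊆ T → c = 0

/-- The tree number `κ(X)`. -/
noncomputable def treeNumber : ℕ := Nat.card {T : Finset A // X.IsSpanningTree T}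

end Basic

section Cochains

variable {V A : Type*} [Fintype A] [DecidableEq V] (X : OrientedGraph V A)

/-- Harmonicity of a cochain `z` (with `z(ē) = -z(e)`): the sum of `z(e)` over all directed edges
with origin `x` vanishes. The edges of the orientation with terminus `x` contribute `-z(e)`. -/
def IsHarmonic (z : A → ℂ) : Prop :=
  ∀ x : V, (∑ e with X.o e = x, z e) + (∑ e with X.t e = x, -z e) = 0

/-- The quadric `Q(X)` in the projective space over `C¹(X, ℂ)`, in coordinate form. -/
def quadric : Set (ℙ ℂ (A → ℂ)) :=
  {p | ∃ (z : A → ℂ) (hz : z ≠ 0),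
    p = Projectivization.mk ℂ z hz ∧ X.IsHarmonic z ∧ ∑ e, z e ^ 2 = 0}

end Cochains

end OrientedGraph

/-- The tight-frame condition for a cochain with values in `ℂ = ℝ²`; the sum runs over all directed
edges, that is over `e` and `ē` for `e` in the orientation. -/
def IsTightFrame {A : Type*} [Fintype A] (z : A → ℂ) : Prop :=
  ∃ c : ℝ, 0 < c ∧ ∀ x : ℂ,
    ∑ e, ((inner ℝ x (z e)) • z e + (inner ℝ x (-z e)) • (-z e)) = c • x

/-- The imaginary quadratic field `ℚ(√-D)` inside `ℂ`. -/
noncomputable def imagQuadField (D : ℕ) : IntermediateField ℚ ℂ :=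
  IntermediateField.adjoin ℚ {Complex.I * ((Real.sqrt (D : ℝ) : ℝ) : ℂ)}

/-- The points of the complex projective space with homogeneous coordinates in `ℚ(√-D)`. -/
def rationalPoints (A : Type*) (D : ℕ) : Set (ℙ ℂ (A → ℂ)) :=
  {p | ∃ (w : A → ℂ) (hw : w ≠ 0),
    p = Projectivization.mk ℂ w hw ∧ ∀ e, w e ∈ imagQuadField D}

/-- `D` is the square-free part of the (positive) integer `n`. -/
def IsSquarefreePart (D : ℕ) (n : ℤ) : Prop :=
  Squarefree D ∧ ∃ m : ℕ, 0 < m ∧ n = (D : ℤ) * (m : ℤ) ^ 2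

/-- The pairing `α · β` of integral 1-chains, for which the edges of the orientation are
orthonormal. -/
def chainPairing {A : Type*} [Fintype A] (α β : A →₀ ℤ) : ℤ := ∑ e, α e * β e

/-- The intersection determinant `I(H) = det (αᵢ · αⱼ)` for a `ℤ`-basis `(αᵢ)` of `H`. It does not
depend on the basis, see `intersectionDet_eq`. -/
noncomputable def intersectionDet {A : Type*} [Fintype A] (H : Submodule ℤ (A →₀ ℤ)) : ℤ :=
  (Matrix.of fun i j => chainPairing (Module.finBasis ℤ H i : A →₀ ℤ)
    (Module.finBasis ℤ H j : A →₀ ℤ)).det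

theorem intersectionDet_eq {A : Type*} [Fintype A] (H : Submodule ℤ (A →₀ ℤ)) {ι : Type*}
    [Fintype ι] [DecidableEq ι] (α : Module.Basis ι ℤ H) :
    intersectionDet H =
      (Matrix.of fun i j => chainPairing (α i : A →₀ ℤ) (α j : A →₀ ℤ)).det := by
  classical
  let B : LinearMap.BilinForm ℤ H := LinearMap.mk₂ ℤ
    (fun x y => chainPairing (x : A →₀ ℤ) (y : A →₀ ℤ))
    (fun x y z => by simp [chainPairing, add_mul, Finset.sum_add_distrib])
    (fun c x y => by simp [chainPairing, Finset.mul_sum, mul_assoc])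
    (fun x y z => by simp [chainPairing, mul_add, Finset.sum_add_distrib])
    (fun c x y => by
      simp only [chainPairing, Finset.mul_sum, smul_eq_mul]
      exact Finset.sum_congr rfl fun e _ => by simp; ring)
  let e : Fin (Module.finrank ℤ H) ≃ ι := (Module.finBasis ℤ H).indexEquiv α
  let β := (Module.finBasis ℤ H).reindex e
  have h1 : intersectionDet H =
      (Matrix.of fun i j => chainPairing (β i : A →₀ ℤ) (β j : A →₀ ℤ)).det := by
    unfold intersectionDet
    rw [← Matrix.det_reindex_self e]
    congr 1
    ext i j
    simp [β]
  have h2 : (Matrix.of fun i j => chainPairing (α i : A →₀ ℤ) (α j : A →₀ ℤ)) =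
      LinearMap.BilinForm.toMatrix α B := by
    ext i j
    rw [LinearMap.BilinForm.toMatrix_apply]
    rfl
  have h3 : (Matrix.of fun i j => chainPairing (β i : A →₀ ℤ) (β j : A →₀ ℤ)) =
      LinearMap.BilinForm.toMatrix β B := by
    ext i j
    rw [LinearMap.BilinForm.toMatrix_apply]
    rfl
  rw [h1, h2, h3, ← LinearMap.BilinForm.toMatrix_mul_basis_toMatrix α β B, Matrix.det_mul, Matrix.det_mul,
    Matrix.det_transpose]
  have hu : (α.toMatrix β).det * (α.toMatrix β).det = 1 := by
    have : IsUnit (α.toMatrix β).det := by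
      have := α.isUnit_det β
      rwa [Module.Basis.det_apply] at this
    rcases Int.isUnit_iff.mp this with h | h <;> rw [h] <;> norm_num
  rw [mul_right_comm, hu, one_mul]

/-- A topological crystal over `X₀` with covering transformation group `L`: a connected covering
graph of `X₀` (with the lifted orientation) on which `L` acts by covering transformations, simply
transitively on the fibres. -/
structure TopologicalCrystal {V₀ A₀ : Type*} (X₀ : OrientedGraph V₀ A₀) (L : Type*)
    [AddCommGroup L] (V A : Type*) extends OrientedGraph V A where
  connected : toOrientedGraph.Connected
  /-- the covering map on vertices -/
  projV : V → V₀
  /-- the covering map on edges -/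
  projA : A → A₀
  projV_o : ∀ e, projV (o e) = X₀.o (projA e)
  projV_t : ∀ e, projV (t e) = X₀.t (projA e)
  /-- Local bijectivity, for the edges leaving `x`. -/
  out_bijOn : ∀ x, Set.BijOn projA {e | o e = x} {e | X₀.o e = projV x}
  /-- Local bijectivity, for the edges arriving at `x`. -/
  in_bijOn : ∀ x, Set.BijOn projA {e | t e = x} {e | X₀.t e = projV x}
  /-- the action of `L` on vertices -/
  actV : AddAction L V
  /-- the action of `L` on edges -/
  actA : AddAction L A
  o_vadd : ∀ (σ : L) (e : A), o (σ +ᵥ e) = σ +ᵥ o e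
  t_vadd : ∀ (σ : L) (e : A), t (σ +ᵥ e) = σ +ᵥ t e
  projV_vadd : ∀ (σ : L) (x : V), projV (σ +ᵥ x) = projV x
  projA_vadd : ∀ (σ : L) (e : A), projA (σ +ᵥ e) = projA e
  simply_transitive : ∀ x y : V, projV x = projV y → ∃! σ : L, σ +ᵥ x = y

namespace TopologicalCrystal

variable {V₀ A₀ L V A : Type*} [AddCommGroup L] {X₀ : OrientedGraph V₀ A₀}
  (X : TopologicalCrystal X₀ L V A)

/-- The vanishing subgroup `H ⊆ H₁(X₀, ℤ)` of the topological crystal: the image of `H₁(X, ℤ)`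
under the covering map, that is, the classes of the closed paths whose lifts to `X` are closed. It
is the kernel of the canonical homomorphism of `H₁(X₀, ℤ)` onto the covering transformation
group. -/
noncomputable def vanishingSubgroup : Submodule ℤ (A₀ →₀ ℤ) :=
  X.toOrientedGraph.H1.map (Finsupp.lmapDomain ℤ ℤ X.projA)

/-- `Φ` (given on vertices and extended linearly to the edges) is a periodic realization of `X` in
the plane with period homomorphism `ρ`: it is equivariant, and `ρ` is injective with image a
lattice. -/
structure IsPeriodicRealization (Φ : V → ℂ) (ρ : L →+ ℂ) : Prop where
  equivariant : ∀ (σ : L) (x : V), letI := X.actV; Φ (σ +ᵥ x) = Φ x + ρ σ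
  injective : Function.Injective ρ
  discrete : DiscreteTopology ρ.range
  span_eq_top : Submodule.span ℝ (ρ.range : Set ℂ) = ⊤

/-- `z` is the building cochain of `Φ`: the cochain `e ↦ Φ(t(e)) - Φ(o(e))`, regarded as a cochain
on `X₀`. -/
def IsBuildingCochain (Φ : V → ℂ) (z : A₀ → ℂ) : Prop :=
  ∀ e : A, z (X.projA e) = Φ (X.t e) - Φ (X.o e)

/-- `Φ` is a standard realization of `X` in the plane, with period homomorphism `ρ` and building
cochain `z`. -/
structure IsStandardRealization [Fintype A₀] [DecidableEq V₀] (Φ : V → ℂ) (ρ : L →+ ℂ)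
    (z : A₀ → ℂ) : Prop where
  periodic : X.IsPeriodicRealization Φ ρ
  building : X.IsBuildingCochain Φ z
  harmonic : X₀.IsHarmonic z
  tight : IsTightFrame z

end TopologicalCrystal

/-! A harmonic cochain is a cycle with complex coefficients, and in ℂ the tight-frame condition
amounts to `∑ e, z e ^ 2 = 0` together with `z ≠ 0`.

Integrating a building cochain `z` over cycles is the canonical homomorphism H₁(X₀, ℤ) → L followed
by `ρ`, so `z` is orthogonal to H. As L is free of rank 2, a basis of H extends by two cycles to a
basis of H₁. The Gram matrix of the whole basis has determinant κ (`intersectionDet_H1`), and its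
H-block has determinant I(H). Eliminating that block leaves a rational binary form of determinant d
= κ / I(H), for which the last two coordinates of `z` are isotropic (`exists_schur_of_isotropic`).
Their ratio generates ℚ(√-d), and the other coordinates are rational combinations of these two. The
point is therefore defined over ℚ(√-D) exactly when κ I(H) = d I(H)² is D times a square
(`OrientedGraph.IsHarmonic.mk_mem_rationalPoints_iff`).

Conversely, a point over ℚ(√-D) rescales to z = x₀ + x₁√-D with integral x₀, x₁. Harmonicity makes
both of them cycles, and isotropy reads x₀·x₀ = D x₁·x₁, x₀·x₁ = 0. So the periods of `z` over x₀
and x₁ are nonzero multiples of 1 and √-D, the period group is a lattice, and the covering graph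
with that group carries a realization with building cochain `z` (`exists_isStandardRealization`).
The first half then identifies D. -/

namespace OrientedGraph

/-! ### Chains, cycles and harmonic cochains -/

section Chains

variable {V A : Type*} (X : OrientedGraph V A)

theorem boundary_single (e : A) (n : ℤ) :
    X.boundary (Finsupp.single e n) = Finsupp.single (X.t e) n - Finsupp.single (X.o e) n := by
  simp [boundary]

theorem mem_H1 {c : A →₀ ℤ} : c ∈ X.H1 ↔ X.boundary c = 0 := LinearMap.mem_ker

/-- Discrete Stokes formula: integrating `f` over `∂ c` is integrating `df` over `c`. -/
theorem linearCombination_boundary {M : Type*} [AddCommGroup M] (f : V → M) (c : A →₀ ℤ) :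
    Finsupp.linearCombination ℤ f (X.boundary c) =
      Finsupp.linearCombination ℤ (fun e => f (X.t e) - f (X.o e)) c := by
  induction c using Finsupp.induction_linear with
  | zero => simp
  | add c d hc hd => rw [map_add, map_add, map_add, hc, hd]
  | single e n => simp [boundary_single, smul_sub]

theorem ConnectedOn.apply_eq {X : OrientedGraph V A} {T : Set A} (hT : X.ConnectedOn T)
    {β : Type*} (f : V → β) (hf : ∀ e ∈ T, f (X.o e) = f (X.t e)) (x y : V) : f x = f y := by
  have h := hT.2 x y
  induction h with
  | rel x y h => obtain ⟨e, he, rfl, rfl⟩ := h; exact hf e he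
  | refl x => rfl
  | symm x y _ ih => exact ih.symm
  | trans x y z _ _ ih₁ ih₂ => exact ih₁.trans ih₂

theorem ConnectedOn.exists_chain {X : OrientedGraph V A} {T : Set A} (hT : X.ConnectedOn T)
    (x y : V) : ∃ c : A →₀ ℤ, (∀ e ∉ T, c e = 0) ∧
      X.boundary c = Finsupp.single y 1 - Finsupp.single x 1 := by
  classical
  have h := hT.2 x y
  induction h with
  | rel x y h =>
    obtain ⟨e, he, rfl, rfl⟩ := h
    refine ⟨Finsupp.single e 1, fun e' he' => ?_, X.boundary_single e 1⟩
    exact Finsupp.single_eq_of_ne fun h => he' (h ▸ he)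
  | refl x => exact ⟨0, fun _ _ => rfl, by simp⟩
  | symm x y _ ih =>
    obtain ⟨c, hc, h⟩ := ih
    exact ⟨-c, fun e he => by simp [hc e he], by simp [h]⟩
  | trans x y z _ _ ih₁ ih₂ =>
    obtain ⟨c, hc, h⟩ := ih₁
    obtain ⟨d, hd, h'⟩ := ih₂
    exact ⟨c + d, fun e he => by simp [hc e he, hd e he], by rw [map_add, h, h']; abel⟩

/-- A family of chains joining a base point to every vertex. -/
theorem Connected.exists_cone {X : OrientedGraph V A} (hX : X.Connected) :
    ∃ (x₀ : V) (k : V → A →₀ ℤ),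
      ∀ x, X.boundary (k x) = Finsupp.single x 1 - Finsupp.single x₀ 1 := by
  obtain ⟨x₀⟩ := hX.1
  choose k _ hk using fun x => ConnectedOn.exists_chain hX x₀ x
  exact ⟨x₀, k, hk⟩

/-- `H₁(X, ℤ)` is a direct summand of the chains, with a projection that differs from the identity
by the coboundary of a chain-valued function on the vertices. -/
theorem Connected.exists_retraction {X : OrientedGraph V A} (hX : X.Connected) :
    ∃ (π : (A →₀ ℤ) →ₗ[ℤ] X.H1) (k : V → A →₀ ℤ), (∀ c : X.H1, π c = c) ∧
      ∀ e, (π (Finsupp.single e 1) : A →₀ ℤ) = Finsupp.single e 1 - (k (X.t e) - k (X.o e)) := by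
  obtain ⟨x₀, k, hk⟩ := hX.exists_cone
  have hmem : ∀ c, c - Finsupp.linearCombination ℤ k (X.boundary c) ∈ X.H1 := by
    intro c
    rw [mem_H1]
    induction c using Finsupp.induction_linear with
    | zero => simp
    | add c d hc hd =>
      have := congrArg₂ (· + ·) hc hd
      simp only [map_sub, map_add, add_zero] at this ⊢
      rw [← this]; abel
    | single e n =>
      simp only [map_sub, boundary_single, Finsupp.linearCombination_single, map_smul, hk]
      rw [← smul_sub, sub_sub_sub_cancel_right, smul_sub, Finsupp.smul_single_one,
        Finsupp.smul_single_one, sub_self]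
  refine ⟨(LinearMap.id - (Finsupp.linearCombination ℤ k).comp X.boundary).codRestrict X.H1 hmem,
    k, fun c => ?_, fun e => ?_⟩
  · ext1
    have : X.boundary c = 0 := c.2
    simp [this]
  · simp [boundary_single]

theorem isHarmonic_iff [Fintype A] [DecidableEq V] (z : A → ℂ) :
    X.IsHarmonic z ↔ ∀ x, ∑ e with X.o e = x, z e = ∑ e with X.t e = x, z e := by
  simp only [IsHarmonic, Finset.sum_neg_distrib, add_neg_eq_zero]

/-- Summation by parts: a harmonic cochain is orthogonal to coboundaries. -/
theorem IsHarmonic.sum_mul_coboundary [Finite V] [Fintype A] [DecidableEq V]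
    {X : OrientedGraph V A} {z : A → ℂ} (hz : X.IsHarmonic z) (f : V → ℂ) :
    ∑ e, z e * (f (X.t e) - f (X.o e)) = 0 := by
  have := Fintype.ofFinite V
  rw [isHarmonic_iff] at hz
  have key : ∀ g : A → V, ∑ e, z e * f (g e) = ∑ x, (∑ e with g e = x, z e) * f x := by
    intro g
    rw [← Finset.sum_fiberwise (s := Finset.univ) (g := g)]
    refine Finset.sum_congr rfl fun x _ => ?_
    rw [Finset.sum_mul]
    refine Finset.sum_congr rfl fun e he => ?_
    rw [(Finset.mem_filter.mp he).2]
  simp only [mul_sub, Finset.sum_sub_distrib, key, hz, sub_self]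

/-- The coordinates of a harmonic cochain with respect to a basis of `H₁(X, ℤ)` are integral
combinations of its values. -/
theorem IsHarmonic.exists_coords [Finite V] [Fintype A] [DecidableEq V]
    {X : OrientedGraph V A} (hX : X.Connected) {ι : Type*} [Fintype ι]
    (b : Module.Basis ι ℤ X.H1) {z : A → ℂ} (hz : X.IsHarmonic z) :
    ∃ r : ι → A → ℤ, ∀ e, z e = ∑ i, (∑ e', z e' * r i e') * ((b i : A →₀ ℤ) e : ℂ) := by
  classical
  obtain ⟨π, k, -, hπ⟩ := hX.exists_retraction
  refine ⟨fun i e' => b.repr (π (Finsupp.single e' 1)) i, fun e => ?_⟩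
  have h1 : ∀ e', ((π (Finsupp.single e' 1) : A →₀ ℤ) e : ℂ) =
      ∑ i, (b.repr (π (Finsupp.single e' 1)) i : ℂ) * ((b i : A →₀ ℤ) e : ℂ) := by
    intro e'
    conv_lhs => rw [← b.sum_repr (π (Finsupp.single e' 1))]
    simp [-Module.Basis.sum_repr, Finsupp.finsetSum_apply]
  -- As a chain, `z` differs from `∑ z e' • π e'` by `∑ z e' • (k (t e') - k (o e'))`, which
  -- vanishes by summation by parts. Expanding each `π e'` in the basis gives the coordinates.
  have h2 := hz.sum_mul_coboundary (fun x => (k x e : ℂ))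
  simp only [Finset.sum_mul, mul_assoc]
  rw [Finset.sum_comm]
  simp only [← Finset.mul_sum, ← h1, hπ]
  simp only [Finsupp.sub_apply, Int.cast_sub, mul_sub] at h2 ⊢
  rw [Finset.sum_sub_distrib, h2, sub_zero]
  simp [Finsupp.single_apply]

end Chains

end OrientedGraph

/-! ### Cauchy–Binet and Gram determinants -/

/-- The Cauchy–Binet formula for the Gram matrix `M * Mᵀ`, the sum being over all families of
columns. -/
theorem Matrix.factorial_mul_det_mul_transpose {ι A R : Type*} [Fintype ι] [DecidableEq ι]
    [Fintype A] [CommRing R] (M : Matrix ι A R) :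
    ((Fintype.card ι).factorial : R) * (M * M.transpose).det =
      ∑ f : ι → A, (M.submatrix id f).det ^ 2 := by
  classical
  have h1 : (M * M.transpose).det =
      ∑ f : ι → A, (∏ i, M i (f i)) * (M.submatrix id f).det := by
    have : M * M.transpose = fun i => ∑ e, M i e • (fun j => M j e) := by
      ext i j
      simp [Matrix.mul_apply, Finset.sum_apply]
    change Matrix.detRowAlternating (M * M.transpose) = _
    rw [this]
    erw [MultilinearMap.map_sum]
    refine Finset.sum_congr rfl fun f _ => ?_
    erw [MultilinearMap.map_smul_univ]
    rw [smul_eq_mul, ← Matrix.det_transpose (M.submatrix id f)]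
    rfl
  -- Relabelling `f` by `σ` preserves the sum and multiplies the minor by the sign of `σ`. Summing
  -- over all `σ` produces the factorial and turns the product of entries into a second copy of the
  -- minor.
  have h2 : ∀ σ : Equiv.Perm ι, (M * M.transpose).det =
      ∑ f : ι → A, ((Equiv.Perm.sign σ : ℤ) : R) * (∏ i, M i (f (σ i))) *
        (M.submatrix id f).det := by
    intro σ
    rw [h1, ← Equiv.sum_comp (Equiv.arrowCongr σ (Equiv.refl A)) fun f : ι → A =>
      ((Equiv.Perm.sign σ : ℤ) : R) * (∏ i, M i (f (σ i))) * (M.submatrix id f).det]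
    refine Finset.sum_congr rfl fun f _ => ?_
    have h : M.submatrix id f =
        (M.submatrix id (Equiv.arrowCongr σ (Equiv.refl A) f)).submatrix id σ := by
      ext i j
      simp
    rw [h, Matrix.det_permute']
    simp
    ring
  have h3 : ∑ σ : Equiv.Perm ι, (M * M.transpose).det =
      ((Fintype.card ι).factorial : R) * (M * M.transpose).det := by
    simp [Fintype.card_perm]
  rw [← h3, Finset.sum_congr rfl fun σ _ => h2 σ, Finset.sum_comm]
  refine Finset.sum_congr rfl fun f _ => ?_
  rw [← Finset.sum_mul, sq]
  congr 1
  rw [← Matrix.det_transpose, Matrix.det_apply']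
  rfl

section Gram

variable {A : Type*} [Fintype A]

/-- The matrix whose rows are the given chains. -/
def chainMatrix {ι : Type*} (α : ι → A →₀ ℤ) : Matrix ι A ℤ := Matrix.of fun i e => α i e

theorem intersectionDet_eq_det_mul_transpose (H : Submodule ℤ (A →₀ ℤ)) {ι : Type*}
    [Fintype ι] [DecidableEq ι] (α : Module.Basis ι ℤ H) :
    intersectionDet H =
      (chainMatrix (fun i => (α i : A →₀ ℤ)) *
        (chainMatrix (fun i => (α i : A →₀ ℤ))).transpose).det := by
  rw [intersectionDet_eq H α]
  rfl

/-- Cauchy–Binet makes the determinant a sum of squares up to a factorial. If it were zero, a null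
vector of the Gram matrix would be a linear relation among the basis chains. -/
theorem intersectionDet_pos (H : Submodule ℤ (A →₀ ℤ)) : 0 < intersectionDet H := by
  set α := Module.finBasis ℤ H
  have h := intersectionDet_eq_det_mul_transpose H α
  set M := chainMatrix (fun i => (α i : A →₀ ℤ)) with hM
  have hnonneg : 0 ≤ intersectionDet H := by
    have h1 := M.factorial_mul_det_mul_transpose
    rw [← h] at h1
    have h2 : (0 : ℤ) ≤ ∑ f, (M.submatrix id f).det ^ 2 :=
      Finset.sum_nonneg fun f _ => sq_nonneg _
    rw [← h1] at h2
    exact nonneg_of_mul_nonneg_right h2 (by exact_mod_cast Nat.factorial_pos _)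
  refine lt_of_le_of_ne hnonneg fun h0 => ?_
  rw [h] at h0
  obtain ⟨v, hv, hv0⟩ := Matrix.exists_vecMul_eq_zero_iff.mpr h0.symm
  have h1 : Matrix.vecMul v M ⬝ᵥ Matrix.vecMul v M = 0 := by
    have : Matrix.vecMul v M ⬝ᵥ Matrix.vecMul v M =
        Matrix.vecMul v (M * M.transpose) ⬝ᵥ v := by
      rw [← Matrix.vecMul_vecMul, Matrix.vecMul_transpose, ← Matrix.dotProduct_mulVec,
        dotProduct_comm]
    rw [this, hv0, zero_dotProduct]
  rw [dotProduct_self_eq_zero] at h1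
  have h2 : ∑ i, v i • α i = 0 := by
    ext e
    have := congrFun h1 e
    simpa [Matrix.vecMul, dotProduct, hM, chainMatrix, Finsupp.finsetSum_apply] using this
  exact hv (funext (Fintype.linearIndependent_iff.mp α.linearIndependent v h2))

end Gram

namespace OrientedGraph

/-! ### Spanning trees and the Gram determinant of the homology -/

section TreeNumber

variable {V A : Type*} {X : OrientedGraph V A}

/-- Adding an edge to a spanning tree closes a cycle. -/
theorem IsSpanningTree.exists_cycle [DecidableEq A] {T : Finset A} (hT : X.IsSpanningTree T)
    (e : A) :
    ∃ c ∈ X.H1, ∀ e' ∉ T, c e' = if e' = e then 1 else 0 := by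
  obtain ⟨c, hc, hb⟩ := hT.1.exists_chain (X.t e) (X.o e)
  refine ⟨Finsupp.single e 1 + c, ?_, fun e' he' => ?_⟩
  · rw [mem_H1, map_add, boundary_single, hb]
    abel
  · rw [Finsupp.add_apply, hc e' (by simpa using he'), Finsupp.single_apply, add_zero]
    simp [eq_comm]

/-- The number of edges outside a spanning tree is the rank of `H₁(X, ℤ)`. -/
theorem IsSpanningTree.nonempty_equiv [Fintype A] {T : Finset A} (hT : X.IsSpanningTree T)
    {ι : Type*} (b : Module.Basis ι ℤ X.H1) :
    Nonempty (ι ≃ {e // e ∉ T}) := by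
  classical
  -- Restriction of cycles to the edges outside `T`: injective because `T` carries no cycle,
  -- surjective by the fundamental cycles.
  let r : X.H1 →ₗ[ℤ] ({e // e ∉ T} → ℤ) :=
    LinearMap.pi fun e => (Finsupp.lapply (e : A)).comp X.H1.subtype
  have hinj : Function.Injective r := by
    rw [← LinearMap.ker_eq_bot, LinearMap.ker_eq_bot']
    intro c hc
    ext1
    refine hT.2 c c.2 fun e he => ?_
    by_contra h
    exact Finsupp.mem_support_iff.mp he (congrFun hc ⟨e, h⟩)
  have hsurj : Function.Surjective r := by
    intro g
    choose c hc hc' using fun e : {e // e ∉ T} => hT.exists_cycle e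
    refine ⟨∑ e, g e • ⟨c e, hc e⟩, funext fun e => ?_⟩
    simp [r, hc' _ _ e.2, Subtype.coe_inj]
  exact ⟨(b.map (LinearEquiv.ofBijective r ⟨hinj, hsurj⟩)).indexEquiv (Pi.basisFun ℤ _)⟩

variable {ι : Type*} [Fintype ι] [DecidableEq ι] (b : Module.Basis ι ℤ X.H1)

/-- The coordinates of the fundamental cycles of `T` form an integral inverse of the minor, which is
therefore a unit. -/
theorem IsSpanningTree.sq_det_eq_one {T : Finset A} (hT : X.IsSpanningTree T)
    (f : ι ≃ {e // e ∉ T}) :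
    ((chainMatrix fun i => (b i : A →₀ ℤ)).submatrix id fun i => (f i : A)).det ^ 2 = 1 := by
  classical
  choose c hc hc' using fun i : ι => hT.exists_cycle (f i)
  have h : (Matrix.of fun i j => b.repr ⟨c i, hc i⟩ j) *
      ((chainMatrix fun i => (b i : A →₀ ℤ)).submatrix id fun i => (f i : A)) = 1 := by
    ext i j
    have h1 := congrArg (fun d : X.H1 => (d : A →₀ ℤ) (f j)) (b.sum_repr ⟨c i, hc i⟩)
    simp only [AddSubmonoidClass.coe_finsetSum, Finsupp.finsetSum_apply, Submodule.coe_smul,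
      Finsupp.smul_apply, smul_eq_mul, hc' i _ (f j).2] at h1
    rw [Matrix.mul_apply]
    refine h1.trans ?_
    simp [Matrix.one_apply, Subtype.coe_inj, eq_comm]
  have hu := congrArg Matrix.det h
  rw [Matrix.det_mul, Matrix.det_one] at hu
  exact Int.isUnit_sq (IsUnit.of_mul_eq_one_right _ hu)

variable [Fintype A]

/-- The adjugate of the minor yields, for each `j`, a cycle that meets the complement of `T` only in
`f j`, with coefficient the determinant. By Stokes, the indicator of a component of `T` takes equal
values at the ends of `f j`, so `T` is connected. A cycle inside `T` has coordinates in the left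
kernel of the minor, hence is zero. -/
theorem isSpanningTree_of_det_ne_zero (hX : X.Connected) {f : ι → A} {T : Finset A}
    (hfT : ∀ e, e ∉ T ↔ e ∈ Set.range f)
    (hf : ((chainMatrix fun i => (b i : A →₀ ℤ)).submatrix id f).det ≠ 0) :
    X.IsSpanningTree T := by
  classical
  set M := (chainMatrix fun i => (b i : A →₀ ℤ)).submatrix id f with hM
  have hcoord : ∀ (v : ι → ℤ) (j : ι),
      (((∑ i, v i • b i : X.H1) : A →₀ ℤ)) (f j) = Matrix.vecMul v M j := by
    intro v j
    simp [Matrix.vecMul, dotProduct, hM, chainMatrix, Finsupp.finsetSum_apply]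
  refine ⟨⟨hX.1, fun x y => ?_⟩, fun c hc hcT => ?_⟩
  · let R := Relation.EqvGen fun u v => ∃ e ∈ (T : Set A), X.o e = u ∧ X.t e = v
    let g : V → ℤ := fun y => if R x y then 1 else 0
    have hgT : ∀ e ∈ T, g (X.t e) - g (X.o e) = 0 := by
      intro e he
      have hR : R (X.o e) (X.t e) := .rel _ _ ⟨e, he, rfl, rfl⟩
      have : R x (X.t e) ↔ R x (X.o e) :=
        ⟨fun h => .trans _ _ _ h (.symm _ _ hR), fun h => .trans _ _ _ h hR⟩
      simp [g, this]
    have hg : ∀ e, g (X.o e) = g (X.t e) := by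
      intro e
      by_cases he : e ∈ T
      · exact (sub_eq_zero.mp (hgT e he)).symm
      · obtain ⟨j, rfl⟩ := (hfT e).mp he
        let c : X.H1 := ∑ i, M.adjugate j i • b i
        have hc : ∀ j', (c : A →₀ ℤ) (f j') = if j = j' then M.det else 0 := by
          intro j'
          have := congrFun (congrFun M.adjugate_mul j) j'
          rw [hcoord, ← Matrix.mul_apply_eq_vecMul]
          simpa [Matrix.one_apply] using this
        have h0 : X.boundary c = 0 := c.2
        have h1 := X.linearCombination_boundary g c
        rw [h0, map_zero, Finsupp.linearCombination_apply, Finsupp.sum_fintype _ _ (by simp),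
          Finset.sum_eq_single (f j)] at h1
        · rw [hc, if_pos rfl, smul_eq_mul] at h1
          have := (mul_eq_zero.mp h1.symm).resolve_left hf
          omega
        · intro e _ hne
          by_cases he : e ∈ T
          · rw [hgT e he, smul_zero]
          · obtain ⟨j', rfl⟩ := (hfT e).mp he
            rw [hc, if_neg (fun h => hne (by rw [h])), zero_smul]
        · simp
    have hxy := ConnectedOn.apply_eq hX g (fun e _ => hg e) x y
    have hxx : R x x := .refl x
    by_contra hne
    simp only [g, if_pos hxx] at hxy
    rw [if_neg hne] at hxy
    exact one_ne_zero hxy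
  · have h1 : Matrix.vecMul (b.repr ⟨c, hc⟩) M = 0 := by
      ext j
      rw [← hcoord, b.sum_repr]
      by_contra h
      exact (hfT (f j)).mpr ⟨j, rfl⟩ (hcT (Finsupp.mem_support_iff.mpr h))
    have h2 := Matrix.eq_zero_of_vecMul_eq_zero hf h1
    have h3 : b.repr ⟨c, hc⟩ = 0 := DFunLike.coe_injective h2
    have h4 := b.repr.map_eq_zero_iff.mp h3
    exact congrArg Subtype.val h4

/-- The tree number is the intersection determinant of `H₁(X, ℤ)`. -/
theorem intersectionDet_H1 (hX : X.Connected) : intersectionDet X.H1 = X.treeNumber := by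
  classical
  set b := Module.finBasis ℤ X.H1
  set n := Module.finrank ℤ X.H1
  have key := (chainMatrix fun i => (b i : A →₀ ℤ)).factorial_mul_det_mul_transpose
  rw [← intersectionDet_eq_det_mul_transpose] at key
  set M := chainMatrix fun i => (b i : A →₀ ℤ)
  let Good := {f : Fin n → A // (M.submatrix id f).det ≠ 0}
  have hcompl : ∀ (f : Fin n → A) e, e ∉ (Finset.univ.image f)ᶜ ↔ e ∈ Set.range f := by
    intro f e
    simp
  have hsq : ∀ f : Fin n → A, (M.submatrix id f).det ^ 2 =
      if (M.submatrix id f).det ≠ 0 then 1 else 0 := by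
    intro f
    split_ifs with h
    · have hinj : Function.Injective f := by
        intro i j hij
        by_contra hne
        exact h (Matrix.det_zero_of_column_eq hne fun k => by simp [hij])
      have hT := isSpanningTree_of_det_ne_zero b hX (hcompl f) h
      exact hT.sq_det_eq_one b ((Equiv.ofInjective f hinj).trans
        (Equiv.subtypeEquivRight fun e => (hcompl f e).symm))
    · rw [not_not.mp h]; rfl
  -- A nonsingular choice of columns is a spanning tree together with a numbering of its complement,
  -- so the sum of squared minors is `n!` times the tree number.
  let F : (Σ T : {T : Finset A // X.IsSpanningTree T}, (Fin n ≃ {e // e ∉ T.1})) → Good :=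
    fun p => ⟨fun i => p.2 i, fun h => by
      have := p.1.2.sq_det_eq_one b p.2
      rw [h] at this
      exact absurd this (by norm_num)⟩
  have hF : Function.Bijective F := by
    constructor
    · rintro ⟨⟨T, hT⟩, g⟩ ⟨⟨T', hT'⟩, g'⟩ h
      have h1 : ∀ i, (g i : A) = g' i := fun i => congrFun (congrArg Subtype.val h) i
      have h2 : T = T' := by
        ext e
        rw [← not_iff_not]
        constructor
        · intro he
          obtain ⟨i, hi⟩ := g.surjective ⟨e, he⟩
          have : (g' i : A) = e := by rw [← h1, hi]
          exact this ▸ (g' i).2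
        · intro he
          obtain ⟨i, hi⟩ := g'.surjective ⟨e, he⟩
          have : (g i : A) = e := by rw [h1, hi]
          exact this ▸ (g i).2
      subst h2
      have h3 : g = g' := Equiv.ext fun i => Subtype.ext (h1 i)
      rw [h3]
    · rintro ⟨f, hf⟩
      have hinj : Function.Injective f := by
        intro i j hij
        by_contra hne
        exact hf (Matrix.det_zero_of_column_eq hne fun k => by simp [hij])
      exact ⟨⟨⟨_, isSpanningTree_of_det_ne_zero b hX (hcompl f) hf⟩,
        (Equiv.ofInjective f hinj).trans
          (Equiv.subtypeEquivRight fun e => (hcompl f e).symm)⟩, rfl⟩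
  have hcard := Fintype.card_congr (Equiv.ofBijective F hF)
  have hfib : ∀ T : {T : Finset A // X.IsSpanningTree T},
      Fintype.card (Fin n ≃ {e // e ∉ T.1}) = n.factorial := by
    intro T
    obtain ⟨g⟩ := T.2.nonempty_equiv b
    rw [Fintype.card_equiv g, Fintype.card_fin]
  rw [Fintype.card_sigma, Finset.sum_congr rfl fun T _ => hfib T, Finset.sum_const,
    Finset.card_univ, ← Nat.card_eq_fintype_card, smul_eq_mul] at hcard
  rw [Finset.sum_congr rfl fun f _ => hsq f, Finset.sum_boole, ← Fintype.card_subtype,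
    ← hcard, Fintype.card_fin] at key
  refine mul_left_cancel₀ (a := (n.factorial : ℤ)) (by exact_mod_cast n.factorial_ne_zero) ?_
  rw [key, treeNumber]
  push_cast
  ring

end TreeNumber

end OrientedGraph

/-! ### Arithmetic of ℚ(√-D) -/

section QuadraticField

theorem I_mul_sqrt_sq (D : ℕ) : (Complex.I * ((Real.sqrt (D : ℝ) : ℝ) : ℂ)) ^ 2 = -(D : ℂ) := by
  rw [mul_pow, Complex.I_sq, ← Complex.ofReal_pow, Real.sq_sqrt (Nat.cast_nonneg D)]
  simp

theorem I_mul_sqrt_mem_imagQuadField (D : ℕ) :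
    Complex.I * ((Real.sqrt (D : ℝ) : ℝ) : ℂ) ∈ imagQuadField D :=
  IntermediateField.mem_adjoin_simple_self ℚ _

theorem ratCast_mem_imagQuadField (D : ℕ) (q : ℚ) : (q : ℂ) ∈ imagQuadField D :=
  (imagQuadField D).algebraMap_mem q

theorem intCast_mem_imagQuadField (D : ℕ) (n : ℤ) : (n : ℂ) ∈ imagQuadField D := by
  exact_mod_cast ratCast_mem_imagQuadField D n

theorem mem_imagQuadField_iff {D : ℕ} {z : ℂ} :
    z ∈ imagQuadField D ↔
      ∃ a b : ℚ, z = a + b * (Complex.I * ((Real.sqrt (D : ℝ) : ℝ) : ℂ)) := by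
  set s := Complex.I * ((Real.sqrt (D : ℝ) : ℝ) : ℂ) with hs
  have hs2 : s ^ 2 = -(D : ℂ) := I_mul_sqrt_sq D
  constructor
  · intro h
    induction h using IntermediateField.adjoin_induction with
    | mem x hx => exact ⟨0, 1, by simpa using hx⟩
    | algebraMap x => exact ⟨x, 0, by simp⟩
    | add x y _ _ hx hy =>
      obtain ⟨a, b, rfl⟩ := hx
      obtain ⟨c, d, rfl⟩ := hy
      exact ⟨a + c, b + d, by push_cast; ring⟩
    | inv x _ hx =>
      obtain ⟨a, b, rfl⟩ := hx
      by_cases h0 : (a : ℂ) + b * s = 0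
      · exact ⟨0, 0, by simp [h0]⟩
      have hn : (a ^ 2 + D * b ^ 2 : ℚ) ≠ 0 := by
        intro hn
        have h1 : a = 0 := by
          nlinarith [sq_nonneg a, mul_nonneg (Nat.cast_nonneg (α := ℚ) D) (sq_nonneg b)]
        rw [h1] at hn h0
        -- `D = 0` is not excluded here; in that case the generator itself is zero.
        have h2 : (D : ℚ) = 0 ∨ b = 0 := by
          rcases mul_eq_zero.mp (by simpa using hn : (D : ℚ) * b ^ 2 = 0) with h | h
          · exact Or.inl h
          · exact Or.inr (pow_eq_zero_iff two_ne_zero |>.mp h)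
        rcases h2 with h2 | h2
        · have : D = 0 := by exact_mod_cast h2
          apply h0
          simp [hs, this]
        · exact h0 (by simp [h2])
      have hn' : ((a : ℂ) ^ 2 + D * b ^ 2) ≠ 0 := by exact_mod_cast hn
      refine ⟨a / (a ^ 2 + D * b ^ 2), -b / (a ^ 2 + D * b ^ 2), ?_⟩
      refine inv_eq_of_mul_eq_one_right ?_
      have hmul : ((a : ℂ) + b * s) * (a - b * s) = a ^ 2 + D * b ^ 2 := by
        linear_combination (-(b : ℂ) ^ 2) * hs2
      rw [← mul_inv_cancel₀ hn']
      nth_rw 1 [← hmul]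
      push_cast
      ring
    | mul x y _ _ hx hy =>
      obtain ⟨a, b, rfl⟩ := hx
      obtain ⟨c, d, rfl⟩ := hy
      refine ⟨a * c - D * (b * d), a * d + b * c, ?_⟩
      push_cast
      linear_combination (b : ℂ) * d * hs2
  · rintro ⟨a, b, rfl⟩
    exact add_mem (ratCast_mem_imagQuadField D a)
      (mul_mem (ratCast_mem_imagQuadField D b) (I_mul_sqrt_mem_imagQuadField D))

theorem re_im_add_mul_I_sqrt (D : ℕ) (a b : ℝ) :
    ((a : ℂ) + b * (Complex.I * ((Real.sqrt (D : ℝ) : ℝ) : ℂ))).re = a ∧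
    ((a : ℂ) + b * (Complex.I * ((Real.sqrt (D : ℝ) : ℝ) : ℂ))).im = b * Real.sqrt D := by
  constructor <;> simp

/-- A negative rational number is a square in `ℚ(√-D)` only if it is `-D` times a rational
square. -/
theorem exists_eq_mul_sq_of_mem_imagQuadField {D : ℕ} (hD : 0 < D) {d : ℚ} (hd : 0 < d) {y : ℂ}
    (hy : y ∈ imagQuadField D) (h : y ^ 2 = -(d : ℂ)) : ∃ t : ℚ, d = D * t ^ 2 := by
  obtain ⟨a, b, rfl⟩ := mem_imagQuadField_iff.mp hy
  have h1 : (((a ^ 2 - D * b ^ 2 : ℚ) : ℝ) : ℂ) + ((2 * a * b : ℚ) : ℝ) *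
      (Complex.I * ((Real.sqrt (D : ℝ) : ℝ) : ℂ)) = -(d : ℂ) := by
    rw [← h]
    push_cast
    linear_combination (-(b : ℂ) ^ 2) * I_mul_sqrt_sq D
  obtain ⟨hre, him⟩ := re_im_add_mul_I_sqrt D ((a ^ 2 - D * b ^ 2 : ℚ) : ℝ) ((2 * a * b : ℚ) : ℝ)
  rw [h1] at hre him
  have hs : Real.sqrt D ≠ 0 := (Real.sqrt_pos.mpr (by exact_mod_cast hD)).ne'
  have hre' : -d = a ^ 2 - D * b ^ 2 := by
    have : ((-d : ℚ) : ℝ) = ((a ^ 2 - D * b ^ 2 : ℚ) : ℝ) := by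
      rw [← hre]
      simp
    exact_mod_cast this
  have him' : 2 * a * b = 0 := by
    have h0 : ((2 * a * b : ℚ) : ℝ) * Real.sqrt D = 0 := by
      rw [← him]
      simp
    exact_mod_cast (mul_eq_zero.mp h0).resolve_right hs
  rcases mul_eq_zero.mp him' with h | h
  · have : a = 0 := by linarith
    exact ⟨b, by rw [this] at hre'; linarith⟩
  · rw [h] at hre'
    nlinarith [sq_nonneg a]

/-- The squared denominator of `m` is coprime to the squared numerator, so it divides `D` and must
be 1. -/
theorem exists_int_of_squarefree_mul_sq {D : ℕ} (hD : Squarefree D) {m : ℚ} {N : ℤ}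
    (h : (N : ℚ) = D * m ^ 2) : ∃ k : ℤ, m = k := by
  have h1 : N * (m.den : ℤ) ^ 2 = D * m.num ^ 2 := by
    have : (N : ℚ) * (m.den : ℚ) ^ 2 = D * (m.num : ℚ) ^ 2 := by
      rw [h, ← Rat.mul_den_eq_num]
      ring
    exact_mod_cast this
  have hcop : IsCoprime ((m.den : ℤ) ^ 2) (m.num ^ 2) :=
    (Int.isCoprime_iff_gcd_eq_one.mpr (by
      rw [Int.gcd_comm]
      simpa [Int.gcd] using m.reduced)).pow
  have h2 : (m.den : ℤ) ^ 2 ∣ D := hcop.dvd_of_dvd_mul_right ⟨N, by rw [← h1]; ring⟩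
  have h3 : m.den * m.den ∣ D := by
    rw [← sq]
    exact_mod_cast h2
  have h4 : m.den = 1 := Nat.isUnit_iff.mp (hD _ h3)
  exact ⟨m.num, (Rat.den_eq_one_iff m).mp h4 |>.symm⟩

end QuadraticField

/-! ### Elimination of the block of H -/

section SchurComplement

open Matrix

/-- A vector isotropic for a rational symmetric form and orthogonal to the first block is determined
rationally by its last two coordinates, which are isotropic for the Schur complement. -/
theorem exists_schur_of_isotropic {ι : Type*} [Fintype ι] [DecidableEq ι]
    (Γ : Matrix (ι ⊕ Fin 2) (ι ⊕ Fin 2) ℚ) (hΓ : Γ.IsSymm) (hP : Γ.toBlocks₁₁.det ≠ 0)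
    (a : ι ⊕ Fin 2 → ℂ)
    (h0 : ∀ i, (Γ.map (algebraMap ℚ ℂ) *ᵥ a) (Sum.inl i) = 0)
    (hiso : a ⬝ᵥ (Γ.map (algebraMap ℚ ℂ) *ᵥ a) = 0) :
    ∃ (C : Matrix ι (Fin 2) ℚ) (g₀ g₁ g₂ : ℚ),
      Γ.det = Γ.toBlocks₁₁.det * (g₀ * g₂ - g₁ ^ 2) ∧
      (∀ i, a (Sum.inl i) = ∑ k, (C i k : ℂ) * a (Sum.inr k)) ∧
      (g₀ : ℂ) * a (Sum.inr 0) ^ 2 + 2 * g₁ * a (Sum.inr 0) * a (Sum.inr 1) +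
        g₂ * a (Sum.inr 1) ^ 2 = 0 := by
  set P := Γ.toBlocks₁₁ with hPdef
  set R := Γ.toBlocks₁₂ with hR
  set S := Γ.toBlocks₂₂ with hS
  have hR' : Γ.toBlocks₂₁ = Rᵀ := by
    ext i j
    exact (hΓ.apply _ _)
  have hblocks : Γ = fromBlocks P R Rᵀ S := by rw [← hR', fromBlocks_toBlocks]
  let φ := algebraMap ℚ ℂ
  set p : ι → ℂ := a ∘ Sum.inl with hp
  set q : Fin 2 → ℂ := a ∘ Sum.inr with hq
  have ha : a = Sum.elim p q := (Sum.elim_comp_inl_inr a).symm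
  have hmul : Γ.map φ *ᵥ a = Sum.elim (P.map φ *ᵥ p + R.map φ *ᵥ q)
      (Rᵀ.map φ *ᵥ p + S.map φ *ᵥ q) := by
    rw [ha, hblocks, fromBlocks_map, fromBlocks_mulVec]
    simp
  have hu : IsUnit P.det := isUnit_iff_ne_zero.mpr hP
  have h1 : P.map φ *ᵥ p + R.map φ *ᵥ q = 0 := by
    ext i
    have := h0 i
    rw [show algebraMap ℚ ℂ = φ from rfl, hmul] at this
    simpa using this
  have h2 : p = (-(P⁻¹ * R)).map φ *ᵥ q := by
    have hinv : (P⁻¹).map φ * P.map φ = 1 := by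
      rw [← Matrix.map_mul, nonsing_inv_mul _ hu, Matrix.map_one _ (map_zero φ) (map_one φ)]
    have h3 : (P⁻¹).map φ *ᵥ (P.map φ *ᵥ p) = p := by
      rw [mulVec_mulVec, hinv, one_mulVec]
    rw [eq_neg_of_add_eq_zero_left h1, mulVec_neg, mulVec_mulVec, ← Matrix.map_mul] at h3
    rw [← h3, ← neg_mulVec]
    congr 1
    ext i j
    simp only [Matrix.neg_apply, Matrix.map_apply, map_neg]
  -- The Schur complement. Once `p` is expressed through `q`, the value of the form depends on `q`
  -- alone through `G`, and `det Γ = det P * det G`.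
  set G : Matrix (Fin 2) (Fin 2) ℚ := S - Rᵀ * P⁻¹ * R with hG
  have h3 : Rᵀ.map φ *ᵥ p + S.map φ *ᵥ q = G.map φ *ᵥ q := by
    rw [h2, mulVec_mulVec, ← Matrix.map_mul, ← add_mulVec]
    congr 1
    rw [← Matrix.map_add φ (map_add φ)]
    congr 1
    rw [hG, Matrix.mul_neg, ← Matrix.mul_assoc]
    abel
  have hPsymm : Pᵀ = P := by
    ext i j
    exact hΓ.apply _ _
  have hSsymm : Sᵀ = S := by
    ext i j
    exact hΓ.apply _ _
  have hGsymm : Gᵀ = G := by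
    rw [hG, transpose_sub, hSsymm, transpose_mul, transpose_mul, transpose_nonsing_inv,
      transpose_transpose, hPsymm, Matrix.mul_assoc]
  have h4 : G 1 0 = G 0 1 := congrFun (congrFun hGsymm 0) 1
  refine ⟨-(P⁻¹ * R), G 0 0, G 0 1, G 1 1, ?_, fun i => ?_, ?_⟩
  · let : Invertible P := P.invertibleOfIsUnitDet hu
    rw [hblocks, det_fromBlocks₁₁, invOf_eq_nonsing_inv, ← hG, det_fin_two G, h4]
    ring
  · have := congrFun h2 i
    simpa [mulVec, dotProduct, hp, hq, φ] using this
  · rw [show algebraMap ℚ ℂ = φ from rfl, hmul, h1, h3, ha, sumElim_dotProduct_sumElim,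
      dotProduct_zero, zero_add] at hiso
    simp only [dotProduct, mulVec, Fin.sum_univ_two, Matrix.map_apply, h4] at hiso
    rw [← hiso]
    simp only [hq, φ, Function.comp_apply, eq_ratCast]
    ring

end SchurComplement

/-! ### Field of definition of an isotropic harmonic cochain -/

namespace OrientedGraph

variable {V A : Type*} [Finite V] [Fintype A] [DecidableEq V] {X : OrientedGraph V A}

/-- The field of definition of an isotropic harmonic cochain orthogonal to a subgroup `H` of corank
two in `H₁(X, ℤ)`. -/
theorem IsHarmonic.mk_mem_rationalPoints_iff (hX : X.Connected) {H : Submodule ℤ (A →₀ ℤ)}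
    {ι : Type*} [Fintype ι] (β : Module.Basis ι ℤ H) (γ : Module.Basis (ι ⊕ Fin 2) ℤ X.H1)
    (hβγ : ∀ i, (γ (Sum.inl i) : A →₀ ℤ) = β i) {z : A → ℂ} (hz : X.IsHarmonic z) (hz0 : z ≠ 0)
    (hiso : ∑ e, z e ^ 2 = 0) (hH : ∀ i, ∑ e, ((β i : A →₀ ℤ) e : ℂ) * z e = 0)
    {D : ℕ} (hD : Squarefree D) :
    Projectivization.mk ℂ z hz0 ∈ rationalPoints A D ↔
      IsSquarefreePart D (X.treeNumber * intersectionDet H) := by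
  classical
  obtain ⟨r, hr'⟩ := hz.exists_coords hX γ
  set a : ι ⊕ Fin 2 → ℂ := fun i => ∑ e', z e' * r i e' with ha
  have hr : ∀ e, z e = ∑ i, a i * ((γ i : A →₀ ℤ) e : ℂ) := hr'
  let Γ : Matrix (ι ⊕ Fin 2) (ι ⊕ Fin 2) ℤ :=
    Matrix.of fun i j => chainPairing (γ i : A →₀ ℤ) (γ j : A →₀ ℤ)
  have hΓdet : Γ.det = X.treeNumber := by
    rw [← intersectionDet_H1 hX, intersectionDet_eq _ γ]
  have hPdet : Γ.toBlocks₁₁.det = intersectionDet H := by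
    rw [intersectionDet_eq _ β]
    congr 1
    ext i j
    simp [Γ, Matrix.toBlocks₁₁, hβγ]
  have hpair : ∀ i, ((Γ.map (Int.castRingHom ℚ)).map (algebraMap ℚ ℂ)).mulVec a i =
      ∑ e, ((γ i : A →₀ ℤ) e : ℂ) * z e := by
    intro i
    simp only [Matrix.mulVec, dotProduct, hr, Finset.mul_sum]
    rw [Finset.sum_comm]
    refine Finset.sum_congr rfl fun j _ => ?_
    simp only [Γ, chainPairing, Matrix.map_apply, Matrix.of_apply]
    simp only [eq_intCast, eq_ratCast, Rat.cast_sum, Rat.cast_mul, Rat.cast_intCast,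
      Int.cast_sum, Int.cast_mul, Finset.sum_mul]
    exact Finset.sum_congr rfl fun e _ => by ring
  have hI : 0 < intersectionDet H := intersectionDet_pos H
  have hκ : (0 : ℤ) < X.treeNumber := by
    rw [← intersectionDet_H1 hX]
    exact intersectionDet_pos _
  set κ : ℤ := (X.treeNumber : ℤ)
  set J := intersectionDet H
  have hdetQ : (Γ.map (Int.castRingHom ℚ)).det = κ := by
    rw [← hΓdet]
    exact ((Int.castRingHom ℚ).map_det Γ).symm
  have hdetP : (Γ.map (Int.castRingHom ℚ)).toBlocks₁₁.det = J := by
    rw [← hPdet]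
    exact ((Int.castRingHom ℚ).map_det Γ.toBlocks₁₁).symm
  have hJ0 : (J : ℚ) ≠ 0 := by exact_mod_cast hI.ne'
  obtain ⟨C, g₀, g₁, g₂, hdet, hC, hquad⟩ := exists_schur_of_isotropic
    (Γ.map (Int.castRingHom ℚ)) (by
      ext i j
      simp [Γ, chainPairing, mul_comm]) (by rw [hdetP]; exact hJ0) a
    (fun i => by rw [hpair, hβγ]; exact hH i) (by
      simp only [dotProduct, hpair, Finset.mul_sum]
      rw [Finset.sum_comm, ← hiso]
      refine Finset.sum_congr rfl fun e _ => ?_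
      rw [sq]
      nth_rw 2 [hr e]
      rw [Finset.sum_mul]
      exact Finset.sum_congr rfl fun i _ => by ring)
  rw [hdetQ, hdetP] at hdet
  set d := g₀ * g₂ - g₁ ^ 2 with hd
  have hdpos : 0 < d := by
    have h1 : (0 : ℚ) < J * d := by rw [← hdet]; exact_mod_cast hκ
    exact pos_of_mul_pos_right h1 (by exact_mod_cast hI.le)
  -- Positivity of `d` is all that is needed of the form: it excludes `g₂ = 0`. Then a vanishing
  -- first coordinate would force the second, and with it all of `z`, to vanish, so the ratio `θ` is
  -- meaningful.
  have hg₂ : g₂ ≠ 0 := by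
    rintro rfl
    nlinarith [sq_nonneg g₁]
  have hg₂' : (g₂ : ℂ) ≠ 0 := by exact_mod_cast hg₂
  have hq₀ : a (Sum.inr 0) ≠ 0 := by
    intro hq
    have hq₁ : a (Sum.inr 1) = 0 := by
      rw [hq] at hquad
      simpa [hg₂'] using hquad
    apply hz0
    ext e
    rw [hr e]
    refine Finset.sum_eq_zero fun i _ => ?_
    have : a i = 0 := by
      rcases i with i | k
      · simp [hC, hq, hq₁]
      · fin_cases k
        · exact hq
        · exact hq₁
    rw [this, zero_mul]
  set θ := a (Sum.inr 1) / a (Sum.inr 0) with hθ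
  have hq₁ : a (Sum.inr 1) = θ * a (Sum.inr 0) := by
    rw [hθ]
    field_simp
  -- Completing the square in the quadratic equation for `θ`.
  have hsq : ((g₂ : ℂ) * θ + g₁) ^ 2 = -(d : ℂ) := by
    rw [hq₁] at hquad
    have h1 : (g₀ : ℂ) + 2 * g₁ * θ + g₂ * θ ^ 2 = 0 := by
      have : ((g₀ : ℂ) + 2 * g₁ * θ + g₂ * θ ^ 2) * a (Sum.inr 0) ^ 2 = 0 := by
        rw [← hquad]
        ring
      exact (mul_eq_zero.mp this).resolve_right (pow_ne_zero 2 hq₀)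
    rw [hd]
    push_cast
    linear_combination (g₂ : ℂ) * h1
  constructor
  · rintro ⟨w, hw, hmk, hwK⟩
    obtain ⟨c, hc⟩ := (Projectivization.mk_eq_mk_iff' ℂ z w hz0 hw).mp hmk
    -- The coordinates are integral combinations of the values, so those of `w` lie in the field,
    -- and their ratio is still `θ`.
    let a' : ι ⊕ Fin 2 → ℂ := fun i => ∑ e', w e' * r i e'
    have ha' : ∀ i, a i = c * a' i := by
      intro i
      simp only [ha, a', ← hc, Pi.smul_apply, smul_eq_mul, Finset.mul_sum, mul_assoc]
    have ha'K : ∀ i, a' i ∈ imagQuadField D := fun i =>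
      sum_mem fun e _ => mul_mem (hwK e) (intCast_mem_imagQuadField D _)
    have hθK : θ ∈ imagQuadField D := by
      have hc0 : c ≠ 0 := by
        rintro rfl
        exact hq₀ (by rw [ha', zero_mul])
      rw [hθ, ha', ha', mul_div_mul_left _ _ hc0]
      exact div_mem (ha'K _) (ha'K _)
    obtain ⟨t, ht⟩ := exists_eq_mul_sq_of_mem_imagQuadField hD.ne_zero.bot_lt hdpos
      (add_mem (mul_mem (ratCast_mem_imagQuadField D g₂) hθK) (ratCast_mem_imagQuadField D g₁)) hsq
    -- From `κ = J * d` and `d = D * t ^ 2`. Since `D` is square-free, `J * t` is then an integer.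
    have hN : ((κ * J : ℤ) : ℚ) = D * (J * t) ^ 2 := by
      push_cast
      rw [hdet, ht]
      ring
    obtain ⟨k, hk⟩ := exists_int_of_squarefree_mul_sq hD hN
    rw [hk] at hN
    have hN' : κ * J = D * k ^ 2 := by exact_mod_cast hN
    refine ⟨hD, k.natAbs, Int.natAbs_pos.mpr ?_, by rw [hN']; simp⟩
    rintro rfl
    have := mul_pos hκ hI
    rw [hN'] at this
    simp at this
  · rintro ⟨-, m, hm, hN⟩
    have hdm : d = D * (m / J) ^ 2 := by
      have h1 : (κ : ℚ) * J = D * m ^ 2 := by exact_mod_cast hN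
      have h2 : (J : ℚ) ^ 2 * d = D * m ^ 2 := by
        rw [← h1, hdet]
        ring
      field_simp
      linarith
    have hyK : (g₂ : ℂ) * θ + g₁ ∈ imagQuadField D := by
      have h1 : ((g₂ : ℂ) * θ + g₁) ^ 2 =
          (((m / J : ℚ) : ℂ) * (Complex.I * ((Real.sqrt (D : ℝ) : ℝ) : ℂ))) ^ 2 := by
        rw [hsq, mul_pow, I_mul_sqrt_sq, hdm]
        push_cast
        ring
      have h2 := mul_mem (ratCast_mem_imagQuadField D (m / J)) (I_mul_sqrt_mem_imagQuadField D)
      rcases sq_eq_sq_iff_eq_or_eq_neg.mp h1 with h | h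
      · rw [h]
        exact h2
      · rw [h]
        exact neg_mem h2
    have hθK : θ ∈ imagQuadField D := by
      have h1 : θ = ((g₂ : ℂ) * θ + g₁ - g₁) / g₂ := by
        field_simp
        ring
      rw [h1]
      exact div_mem (sub_mem hyK (ratCast_mem_imagQuadField D g₁)) (ratCast_mem_imagQuadField D g₂)
    -- With the first of the last two coordinates scaled to 1, the second becomes `θ` and the others
    -- are rational combinations of 1 and `θ`.
    have haK : ∀ i, (a (Sum.inr 0))⁻¹ * a i ∈ imagQuadField D := by
      have hinr : ∀ k, (a (Sum.inr 0))⁻¹ * a (Sum.inr k) ∈ imagQuadField D := by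
        intro k
        fin_cases k
        · simp only [Fin.zero_eta, inv_mul_cancel₀ hq₀]
          exact one_mem _
        · simp only [Fin.mk_one, hq₁]
          rwa [mul_left_comm, inv_mul_cancel₀ hq₀, mul_one]
      rintro (i | k)
      · rw [hC, Finset.mul_sum]
        refine sum_mem fun k _ => ?_
        rw [mul_left_comm]
        exact mul_mem (ratCast_mem_imagQuadField D _) (hinr k)
      · exact hinr k
    have hw : (a (Sum.inr 0))⁻¹ • z ≠ 0 := smul_ne_zero (inv_ne_zero hq₀) hz0
    refine ⟨(a (Sum.inr 0))⁻¹ • z, hw, ?_, fun e => ?_⟩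
    · rw [Projectivization.mk_eq_mk_iff']
      exact ⟨a (Sum.inr 0), by rw [smul_smul, mul_inv_cancel₀ hq₀, one_smul]⟩
    · rw [Pi.smul_apply, smul_eq_mul, hr e, Finset.mul_sum]
      refine sum_mem fun i _ => ?_
      rw [← mul_assoc]
      exact mul_mem (haK i) (intCast_mem_imagQuadField D _)

end OrientedGraph

/-! ### Canonical homomorphism and vanishing subgroup -/

namespace TopologicalCrystal

variable {V₀ A₀ L V A : Type*} [AddCommGroup L] {X₀ : OrientedGraph V₀ A₀}
  (X : TopologicalCrystal X₀ L V A)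

theorem boundary_map_projA (c : A →₀ ℤ) :
    X₀.boundary (Finsupp.lmapDomain ℤ ℤ X.projA c) =
      Finsupp.lmapDomain ℤ ℤ X.projV (X.toOrientedGraph.boundary c) := by
  induction c using Finsupp.induction_linear with
  | zero => simp
  | add c d hc hd => simp only [map_add, hc, hd]
  | single e n =>
    simp only [OrientedGraph.boundary_single, map_sub, Finsupp.lmapDomain_apply,
      Finsupp.mapDomain_single, projV_o, projV_t]

theorem vanishingSubgroup_le : X.vanishingSubgroup ≤ X₀.H1 := by
  rintro _ ⟨c, hc, rfl⟩
  rw [OrientedGraph.mem_H1, boundary_map_projA, (OrientedGraph.mem_H1 _).mp hc, map_zero]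

/-- Edges lift in both directions, so membership in the image is constant along edges of the
connected base. -/
theorem projV_surjective (hX₀ : X₀.Connected) : Function.Surjective X.projV := by
  obtain ⟨x₀⟩ := X.connected.1
  intro y
  have key : ∀ e ∈ Set.univ, (X₀.o e ∈ Set.range X.projV) = (X₀.t e ∈ Set.range X.projV) := by
    rintro e -
    refine propext ⟨?_, ?_⟩
    · rintro ⟨x, hx⟩
      obtain ⟨e', -, rfl⟩ := (X.out_bijOn x).surjOn (show X₀.o e = X.projV x from hx.symm)
      exact ⟨X.t e', X.projV_t e'⟩
    · rintro ⟨x, hx⟩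
      obtain ⟨e', -, rfl⟩ := (X.in_bijOn x).surjOn (show X₀.t e = X.projV x from hx.symm)
      exact ⟨X.o e', X.projV_o e'⟩
  have h := OrientedGraph.ConnectedOn.apply_eq hX₀ (fun y => y ∈ Set.range X.projV) key
    (X.projV x₀) y
  exact h.mp ⟨x₀, rfl⟩

/-- Lifts of the vertices and of the edges of `X₀`, and the resulting `L`-valued cochain. -/
theorem exists_voltage (hX₀ : X₀.Connected) :
    letI := X.actV
    ∃ (s : V₀ → V) (l : A₀ → A) (u : A₀ → L), (∀ e, X.projA (l e) = e) ∧
      (∀ e, X.o (l e) = s (X₀.o e)) ∧ ∀ e, X.t (l e) = u e +ᵥ s (X₀.t e) := by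
  let := X.actV
  choose s hs using X.projV_surjective hX₀
  choose l hlo hl using fun e => (X.out_bijOn (s (X₀.o e))).surjOn
    (show X₀.o e = X.projV (s (X₀.o e)) from (hs _).symm)
  choose u hu _ using fun e => X.simply_transitive (s (X₀.t e)) (X.t (l e))
    (by rw [hs, X.projV_t, hl])
  exact ⟨s, l, u, hl, hlo, fun e => (hu e).symm⟩

/-- A cycle on which the `L`-valued cochain `u` vanishes is the image of a cycle of `X`. -/
theorem mem_vanishingSubgroup_of_voltage {s : V₀ → V} {l : A₀ → A} {u : A₀ → L}
    (hl : ∀ e, X.projA (l e) = e) (hlo : ∀ e, X.o (l e) = s (X₀.o e))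
    (hlt : letI := X.actV; ∀ e, X.t (l e) = u e +ᵥ s (X₀.t e)) {α : A₀ →₀ ℤ} (hα : α ∈ X₀.H1)
    (hu : Finsupp.linearCombination ℤ u α = 0) : α ∈ X.vanishingSubgroup := by
  let := X.actV
  let := X.actA
  obtain ⟨x₀⟩ := X.connected.1
  -- Vertex chains are taken modulo boundaries of edge chains that project to zero. Modulo `B` the
  -- difference of `σ +ᵥ x` and `x` does not depend on `x`, because the difference of `σ +ᵥ e` and
  -- `e` projects to zero; this makes `κ` a homomorphism on `L`.
  let B : Submodule ℤ (V →₀ ℤ) :=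
    (LinearMap.ker (Finsupp.lmapDomain ℤ ℤ X.projA)).map X.toOrientedGraph.boundary
  let δ : L → V → (V →₀ ℤ) ⧸ B := fun σ x =>
    B.mkQ (Finsupp.single (σ +ᵥ x) 1 - Finsupp.single x 1)
  have hδ : ∀ σ x y, δ σ x = δ σ y := by
    intro σ x y
    refine OrientedGraph.ConnectedOn.apply_eq X.connected (δ σ) (fun e _ => ?_) x y
    refine Eq.symm ((Submodule.Quotient.eq B).mpr
      ⟨Finsupp.single (σ +ᵥ e) 1 - Finsupp.single e 1, ?_, ?_⟩)
    · change Finsupp.lmapDomain ℤ ℤ X.projA _ = 0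
      simp only [map_sub, Finsupp.lmapDomain_apply, Finsupp.mapDomain_single, X.projA_vadd,
        sub_self]
    · rw [map_sub, OrientedGraph.boundary_single, OrientedGraph.boundary_single,
        X.o_vadd, X.t_vadd]
      abel
  let κ : L →+ (V →₀ ℤ) ⧸ B := AddMonoidHom.mk' (fun σ => δ σ x₀) fun σ τ => by
    change δ (σ + τ) x₀ = δ σ x₀ + δ τ x₀
    rw [hδ σ x₀ (τ +ᵥ x₀)]
    simp only [δ]
    rw [← map_add, add_vadd]
    congr 1
    abel
  have hκ : ∀ σ x, B.mkQ (Finsupp.single (σ +ᵥ x) 1) = κ σ + B.mkQ (Finsupp.single x 1) := by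
    intro σ x
    rw [← sub_eq_iff_eq_add, ← map_sub]
    exact hδ σ x x₀
  -- Modulo `B`, the boundary of an edgewise lift consists of the total voltage and the lifted
  -- boundary. For a cycle of zero voltage both vanish, so a chain `k` projecting to zero can be
  -- subtracted to close the lift.
  have hq : ∀ β : A₀ →₀ ℤ,
      B.mkQ (X.toOrientedGraph.boundary (Finsupp.lmapDomain ℤ ℤ l β)) =
        κ (Finsupp.linearCombination ℤ u β) +
          Finsupp.linearCombination ℤ (fun x => B.mkQ (Finsupp.single (s x) 1))
            (X₀.boundary β) := by
    intro β
    induction β using Finsupp.induction_linear with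
    | zero => simp
    | add β γ hβ hγ =>
      simp only [map_add, hβ, hγ]
      abel
    | single e n =>
      rw [← Finsupp.smul_single_one e n]
      simp only [map_smul, map_zsmul, Finsupp.lmapDomain_apply, Finsupp.mapDomain_single,
        OrientedGraph.boundary_single, Finsupp.linearCombination_single, one_smul, map_sub, hlo,
        hlt, hκ]
      rw [← smul_add]
      congr 1
      abel
  have h0 := hq α
  rw [hu, (OrientedGraph.mem_H1 _).mp hα, map_zero, map_zero, add_zero] at h0
  obtain ⟨k, hk, hk'⟩ := (Submodule.Quotient.mk_eq_zero B).mp h0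
  refine ⟨Finsupp.lmapDomain ℤ ℤ l α - k, ?_, ?_⟩
  · rw [SetLike.mem_coe, OrientedGraph.mem_H1, map_sub, hk', sub_self]
  · have : Finsupp.lmapDomain ℤ ℤ X.projA k = 0 := hk
    rw [map_sub, this, sub_zero, Finsupp.lmapDomain_apply, Finsupp.lmapDomain_apply,
      ← Finsupp.mapDomain_comp, show X.projA ∘ l = id from funext hl, Finsupp.mapDomain_id]

variable {X}

theorem IsBuildingCochain.linearCombination_map {Φ : V → ℂ} {z : A₀ → ℂ}
    (h : X.IsBuildingCochain Φ z) (c : A →₀ ℤ) :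
    Finsupp.linearCombination ℤ z (Finsupp.lmapDomain ℤ ℤ X.projA c) =
      Finsupp.linearCombination ℤ Φ (X.toOrientedGraph.boundary c) := by
  rw [OrientedGraph.linearCombination_boundary, Finsupp.lmapDomain_apply,
    Finsupp.linearCombination_mapDomain]
  congr 1
  congr 1
  exact funext h

/-- The canonical homomorphism of `H₁(X₀, ℤ)` onto `L`, with kernel the vanishing subgroup, and the
integration of the building cochain. -/
theorem IsPeriodicRealization.exists_canonicalHom {Φ : V → ℂ} {ρ : L →+ ℂ} {z : A₀ → ℂ}
    (hX₀ : X₀.Connected) (hp : X.IsPeriodicRealization Φ ρ) (hb : X.IsBuildingCochain Φ z) :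
    ∃ f : X₀.H1 →ₗ[ℤ] L, Function.Surjective f ∧
      (∀ α, f α = 0 ↔ (α : A₀ →₀ ℤ) ∈ X.vanishingSubgroup) ∧
      ∀ α, ρ (f α) = Finsupp.linearCombination ℤ z (α : A₀ →₀ ℤ) := by
  let := X.actV
  obtain ⟨s, l, u, hl, hlo, hlt⟩ := X.exists_voltage hX₀
  have hz : ∀ α ∈ X₀.H1, ρ (Finsupp.linearCombination ℤ u α) =
      Finsupp.linearCombination ℤ z α := by
    intro α hα
    -- The building cochain is `ρ ∘ u` plus the coboundary of `Φ ∘ s`, which integrates to zero over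
    -- cycles.
    have h1 : z = (fun e => ρ (u e)) + fun e => Φ (s (X₀.t e)) - Φ (s (X₀.o e)) := by
      ext e
      have := hb (l e)
      rw [hl, hlt, hlo, hp.equivariant] at this
      rw [this, Pi.add_apply]
      ring
    have h2 := X₀.linearCombination_boundary (fun x => Φ (s x)) α
    rw [(OrientedGraph.mem_H1 _).mp hα, map_zero] at h2
    rw [h1]
    simp only [Finsupp.linearCombination_apply, Finsupp.sum, Pi.add_apply, smul_add,
      Finset.sum_add_distrib, map_sum, map_zsmul] at h2 ⊢
    rw [← h2, add_zero]
  refine ⟨(Finsupp.linearCombination ℤ u).comp X₀.H1.subtype, ?_,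
    fun α => ⟨fun h => ?_, fun h => ?_⟩, fun α => hz α α.2⟩
  · intro σ
    obtain ⟨x⟩ := X.connected.1
    -- A chain from `x` to `σ +ᵥ x` projects to a cycle whose image is `σ`; as `ρ` is injective,
    -- this can be checked on the values of `Φ`.
    obtain ⟨c, -, hc⟩ := OrientedGraph.ConnectedOn.exists_chain X.connected x (σ +ᵥ x)
    have hα : Finsupp.lmapDomain ℤ ℤ X.projA c ∈ X₀.H1 := by
      rw [OrientedGraph.mem_H1, boundary_map_projA, hc]
      simp only [map_sub, Finsupp.lmapDomain_apply, Finsupp.mapDomain_single, X.projV_vadd,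
        sub_self]
    refine ⟨⟨_, hα⟩, hp.injective ?_⟩
    refine (hz _ hα).trans ?_
    rw [hb.linearCombination_map, hc]
    simp [hp.equivariant]
  · exact X.mem_vanishingSubgroup_of_voltage hl hlo hlt α.2 h
  · obtain ⟨c, hc, hcα⟩ := h
    refine hp.injective ?_
    refine (hz α α.2).trans ?_
    rw [← hcα, hb.linearCombination_map, (OrientedGraph.mem_H1 _).mp hc, map_zero, map_zero]

end TopologicalCrystal

/-- A basis of a subgroup with free quotient extends to a basis. -/
theorem exists_basis_sum_of_surjective {C L ι κ : Type*} [AddCommGroup C] [AddCommGroup L]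
    {H K : Submodule ℤ C} (hHK : H ≤ K) (f : K →ₗ[ℤ] L) (hf : Function.Surjective f)
    (hker : ∀ a, f a = 0 ↔ (a : C) ∈ H) (β : Module.Basis ι ℤ H) (b : Module.Basis κ ℤ L) :
    ∃ γ : Module.Basis (ι ⊕ κ) ℤ K, ∀ i, (γ (Sum.inl i) : C) = β i := by
  have := Module.Free.of_basis b
  -- Freeness of `L` gives a section of `f`, hence a splitting of `K` as `H × L`.
  obtain ⟨g, hg⟩ := Module.projective_lifting_property f LinearMap.id hf
  have hg' : ∀ l, f (g l) = l := fun l => LinearMap.congr_fun hg l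
  let F : (H × L) →ₗ[ℤ] K := (Submodule.inclusion hHK).coprod g
  have hF : ∀ x, F x = Submodule.inclusion hHK x.1 + g x.2 := fun x => rfl
  have hfH : ∀ h : H, f (Submodule.inclusion hHK h) = 0 := fun h => (hker _).mpr h.2
  have hbij : Function.Bijective F := by
    constructor
    · rw [← LinearMap.ker_eq_bot, LinearMap.ker_eq_bot']
      rintro ⟨h, l⟩ h0
      have h1 : l = 0 := by
        have := congrArg f h0
        rwa [hF, map_add, hfH, hg', zero_add, map_zero] at this
      rw [hF, h1, map_zero, add_zero] at h0
      have h2 : h = 0 := Submodule.inclusion_injective hHK (by rw [h0, map_zero])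
      rw [h1, h2]
      rfl
    · intro a
      have ha : ((a - g (f a) : K) : C) ∈ H := by
        rw [← hker, map_sub, hg', sub_self]
      refine ⟨(⟨_, ha⟩, f a), ?_⟩
      rw [hF]
      ext1
      simp
  refine ⟨(β.prod b).map (LinearEquiv.ofBijective F hbij), fun i => ?_⟩
  simp [hF]

/-! ### Tight frames in the plane as isotropic vectors -/

section TightFrame

variable {A : Type*} [Fintype A] {z : A → ℂ}

/-- The condition at `1` plus `I` times the condition at `I` has left side `2 * ∑ z e ^ 2` and right
side `c + I * (c * I) = 0`. -/
theorem IsTightFrame.sum_sq_eq_zero (h : IsTightFrame z) : ∑ e, z e ^ 2 = 0 := by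
  obtain ⟨c, -, hc⟩ := h
  have h1 := hc 1
  have h2 := hc Complex.I
  have h3 : (2 : ℂ) * ∑ e, z e ^ 2 = (c • (1 : ℂ)) + Complex.I * (c • Complex.I) := by
    rw [← h1, ← h2, Finset.mul_sum, Finset.mul_sum, ← Finset.sum_add_distrib]
    refine Finset.sum_congr rfl fun e _ => ?_
    apply Complex.ext <;> simp [sq, Complex.inner] <;> ring
  have h4 : (c • (1 : ℂ)) + Complex.I * (c • Complex.I) = 0 := by
    apply Complex.ext <;> simp
  rw [h4] at h3
  exact (mul_eq_zero.mp h3).resolve_left two_ne_zero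

theorem IsTightFrame.ne_zero (h : IsTightFrame z) : z ≠ 0 := by
  rintro rfl
  obtain ⟨c, hc, h⟩ := h
  have := h 1
  simp only [Pi.zero_apply, smul_zero, neg_zero, add_zero, Finset.sum_const_zero] at this
  exact smul_ne_zero hc.ne' one_ne_zero this.symm

/-- Edge by edge, 2⟨x, z⟩z = |z|² x + x̄ z². The second terms sum to zero, so the frame constant is
∑ |z|². -/
theorem isTightFrame_of_sum_sq_eq_zero (hz : z ≠ 0) (h : ∑ e, z e ^ 2 = 0) : IsTightFrame z := by
  refine ⟨∑ e, Complex.normSq (z e), ?_, fun x => ?_⟩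
  · obtain ⟨e, he⟩ := Function.ne_iff.mp hz
    exact Finset.sum_pos' (fun e _ => Complex.normSq_nonneg _)
      ⟨e, Finset.mem_univ e, Complex.normSq_pos.mpr he⟩
  · have h1 : (∑ e, Complex.normSq (z e)) • x =
        (∑ e, Complex.normSq (z e)) • x + (starRingEnd ℂ) x * ∑ e, z e ^ 2 := by
      rw [h, mul_zero, add_zero]
    rw [h1, Finset.mul_sum, Finset.sum_smul, ← Finset.sum_add_distrib]
    refine Finset.sum_congr rfl fun e _ => ?_
    apply Complex.ext <;> simp [sq, Complex.inner, Complex.normSq_apply] <;> ring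

end TightFrame

/-- The canonical homomorphism supplies what the criterion for cochains needs: its kernel H has a
complement of rank two, and the periods over H are `ρ 0 = 0`. -/
theorem TopologicalCrystal.IsStandardRealization.mk_mem_rationalPoints_iff
    {V₀ A₀ L V A : Type*} [Finite V₀] [Fintype A₀] [DecidableEq V₀] [AddCommGroup L]
    [Module.Free ℤ L] (hL : Module.finrank ℤ L = 2) {X₀ : OrientedGraph V₀ A₀}
    (hX₀ : X₀.Connected) {X : TopologicalCrystal X₀ L V A} {Φ : V → ℂ} {ρ : L →+ ℂ} {z : A₀ → ℂ}
    (h : X.IsStandardRealization Φ ρ z) {D : ℕ} (hD : Squarefree D) :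
    Projectivization.mk ℂ z h.tight.ne_zero ∈ rationalPoints A₀ D ↔
      IsSquarefreePart D (X₀.treeNumber * intersectionDet X.vanishingSubgroup) := by
  have : Module.Finite ℤ L := Module.finite_of_finrank_pos (by omega)
  obtain ⟨f, hf, hker, hz⟩ := h.periodic.exists_canonicalHom hX₀ h.building
  let β := Module.finBasis ℤ X.vanishingSubgroup
  obtain ⟨γ, hγ⟩ := exists_basis_sum_of_surjective X.vanishingSubgroup_le f hf hker β
    (Module.finBasisOfFinrankEq ℤ L hL)
  refine h.harmonic.mk_mem_rationalPoints_iff hX₀ β γ hγ _ h.tight.sum_sq_eq_zero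
    (fun i => ?_) hD
  have h1 := hz (γ (Sum.inl i))
  rw [(hker _).mpr (by rw [hγ]; exact (β i).2), map_zero, hγ, Finsupp.linearCombination_apply,
    Finsupp.sum_fintype _ _ (by simp)] at h1
  simpa using h1.symm

/-! ### Covering graphs derived from voltages -/

namespace OrientedGraph

section Voltage

variable {V A M : Type*} [AddCommGroup M] (X : OrientedGraph V A)

/-- The covering graph of `X` derived from a cochain `u` with values in the group `M`. -/
def voltageGraph (u : A → M) : OrientedGraph (V × M) (A × M) where
  o p := (X.o p.1, p.2)
  t p := (X.t p.1, p.2 + u p.1)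

variable {X}

/-- The derived covering graph is connected when the cycles attain all voltages. -/
theorem voltageGraph_connected (hX : X.Connected) (u : A → M)
    (hu : ∀ m, ∃ α ∈ X.H1, Finsupp.linearCombination ℤ u α = m) :
    (X.voltageGraph u).Connected := by
  obtain ⟨x₀⟩ := hX.1
  let R : V × M → V × M → Prop := Relation.EqvGen fun p q =>
    ∃ e ∈ Set.univ, (X.voltageGraph u).o e = p ∧ (X.voltageGraph u).t e = q
  have hRe : ∀ e m, R (X.o e, m) (X.t e, m + u e) := fun e m =>
    .rel _ _ ⟨(e, m), Set.mem_univ _, rfl, rfl⟩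
  have htrans : ∀ {p q} (k : M), R p q → R (p.1, p.2 + k) (q.1, q.2 + k) := by
    intro p q k h
    induction h with
    | rel p q h =>
      obtain ⟨⟨e, m⟩, -, rfl, rfl⟩ := h
      have := hRe e (m + k)
      rwa [add_right_comm] at this
    | refl p => exact .refl _
    | symm p q _ ih => exact .symm _ _ ih
    | trans p q r _ _ ih₁ ih₂ => exact .trans _ _ _ ih₁ ih₂
  have hs : ∀ x, ∃ m, R (x₀, 0) (x, m) := by
    intro x
    have h := ConnectedOn.apply_eq hX (fun x => ∃ m, R (x₀, 0) (x, m)) (fun e _ => propext ⟨?_, ?_⟩)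
      x₀ x
    · exact h.mp ⟨0, .refl _⟩
    · rintro ⟨m, hm⟩
      exact ⟨_, .trans _ _ _ hm (hRe e m)⟩
    · rintro ⟨m, hm⟩
      have := hRe e (m - u e)
      rw [sub_add_cancel] at this
      exact ⟨_, .trans _ _ _ hm (.symm _ _ this)⟩
  choose s hs using hs
  -- The voltages that connect the base fibre to itself. Modulo `S` the cochain `u` is the
  -- coboundary of `s`, so its sum over any cycle lies in `S`; by assumption these sums exhaust `M`.
  let S : AddSubgroup M :=
    { carrier := {m | R (x₀, 0) (x₀, m)}
      zero_mem' := .refl _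
      add_mem' := fun {a b} ha hb => by
        have := htrans b ha
        rw [zero_add] at this
        exact .trans _ _ _ hb this
      neg_mem' := fun {a} ha => by
        have := htrans (-a) ha
        rw [zero_add, add_neg_cancel] at this
        exact .symm _ _ this }
  have hS : ∀ m, m ∈ S := by
    intro m
    obtain ⟨α, hα, rfl⟩ := hu m
    let q := QuotientAddGroup.mk' S
    have hq : ∀ e, q (u e) = q (s (X.t e)) - q (s (X.o e)) := by
      intro e
      rw [← map_sub, eq_comm]
      refine (QuotientAddGroup.mk'_eq_mk' S).mpr
        ⟨s (X.o e) + u e - s (X.t e), ?_, by abel⟩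
      have h1 : R (x₀, 0) (X.t e, s (X.o e) + u e) := .trans _ _ _ (hs (X.o e)) (hRe e _)
      have h2 := htrans (s (X.o e) + u e - s (X.t e)) (hs (X.t e))
      simp only [zero_add, add_sub_cancel] at h2
      exact .trans _ _ _ h1 (.symm _ _ h2)
    have h1 : q (Finsupp.linearCombination ℤ u α) =
        Finsupp.linearCombination ℤ (fun e => q (u e)) α := by
      simp only [Finsupp.linearCombination_apply, Finsupp.sum, map_sum, map_zsmul]
    rw [← QuotientAddGroup.eq_zero_iff]
    refine h1.trans ?_
    simp only [hq]
    rw [← X.linearCombination_boundary (fun x => q (s x)), (X.mem_H1).mp hα, map_zero]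
  have hall : ∀ p, R (x₀, 0) p := by
    rintro ⟨x, m⟩
    have h1 : R (x₀, 0) (x₀, m - s x) := hS _
    have h2 := htrans (m - s x) (hs x)
    simp only [zero_add, add_sub_cancel] at h2
    exact .trans _ _ _ h1 h2
  exact ⟨⟨(x₀, 0)⟩, fun p q => .trans _ _ _ (.symm _ _ (hall p)) (hall q)⟩

/-- The topological crystal derived from a cochain with values in a copy `M` of `L`. -/
def voltageCrystal {L : Type*} [AddCommGroup L] (ε : L ≃+ M) (u : A → M)
    (h : (X.voltageGraph u).Connected) : TopologicalCrystal X L (V × M) (A × M) where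
  toOrientedGraph := X.voltageGraph u
  connected := h
  projV := Prod.fst
  projA := Prod.fst
  projV_o _ := rfl
  projV_t _ := rfl
  out_bijOn := by
    rintro ⟨x, m⟩
    refine ⟨?_, ?_, ?_⟩
    · rintro ⟨e, k⟩ he
      exact congrArg Prod.fst he
    · rintro ⟨e, k⟩ he ⟨e', k'⟩ he' hee
      have h1 : k = m := congrArg Prod.snd he
      have h2 : k' = m := congrArg Prod.snd he'
      exact Prod.ext hee (h1.trans h2.symm)
    · rintro e he
      exact ⟨(e, m), Prod.ext he rfl, rfl⟩
  in_bijOn := by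
    rintro ⟨x, m⟩
    refine ⟨?_, ?_, ?_⟩
    · rintro ⟨e, k⟩ he
      exact congrArg Prod.fst he
    · rintro ⟨e, k⟩ he ⟨e', k'⟩ he' hee
      have h0 : e = e' := hee
      subst h0
      have h1 : k + u e = m := congrArg Prod.snd he
      have h2 : k' + u e = m := congrArg Prod.snd he'
      exact Prod.ext rfl (add_right_cancel (h1.trans h2.symm))
    · rintro e he
      exact ⟨(e, m - u e), Prod.ext he (sub_add_cancel m (u e)), rfl⟩
  actV :=
    { vadd := fun σ p => (p.1, p.2 + ε σ)
      zero_vadd := fun p => Prod.ext rfl (by change p.2 + ε 0 = p.2; simp)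
      add_vadd := fun σ τ p => Prod.ext rfl (by
        change p.2 + ε (σ + τ) = p.2 + ε τ + ε σ
        rw [map_add]
        abel) }
  actA :=
    { vadd := fun σ p => (p.1, p.2 + ε σ)
      zero_vadd := fun p => Prod.ext rfl (by change p.2 + ε 0 = p.2; simp)
      add_vadd := fun σ τ p => Prod.ext rfl (by
        change p.2 + ε (σ + τ) = p.2 + ε τ + ε σ
        rw [map_add]
        abel) }
  o_vadd _ _ := rfl
  t_vadd σ p := Prod.ext rfl (add_right_comm p.2 (ε σ) (u p.1))
  projV_vadd _ _ := rfl
  projA_vadd _ _ := rfl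
  simply_transitive := by
    rintro ⟨x, m⟩ ⟨y, n⟩ hxy
    refine ⟨ε.symm (n - m), Prod.ext hxy ?_, fun σ hσ => ?_⟩
    · change m + ε (ε.symm (n - m)) = n
      simp
    · have h1 : m + ε σ = n := congrArg Prod.snd hσ
      rw [← h1]
      simp

end Voltage

theorem boundary_apply {V A : Type*} [Fintype A] [DecidableEq V] (X : OrientedGraph V A)
    (c : A →₀ ℤ) (x : V) :
    X.boundary c x = ∑ e with X.t e = x, c e - ∑ e with X.o e = x, c e := by
  classical
  induction c using Finsupp.induction_linear with
  | zero => simp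
  | add c d hc hd =>
    simp only [map_add, Finsupp.add_apply, hc, hd, Finset.sum_add_distrib]
    ring
  | single e n =>
    simp [boundary_single, Finsupp.single_apply, Finset.sum_ite_eq]

end OrientedGraph

/-! ### Integral representatives and their standard realizations -/

/-- The lattice `ℤ + ℤ√-D` in the complex plane. -/
noncomputable def quadraticLattice (D : ℕ) : (Fin 2 → ℤ) →ₗ[ℤ] ℂ :=
  Fintype.linearCombination ℤ ![1, Complex.I * ((Real.sqrt (D : ℝ) : ℝ) : ℂ)]

theorem quadraticLattice_apply (D : ℕ) (v : Fin 2 → ℤ) :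
    quadraticLattice D v = v 0 + v 1 * (Complex.I * ((Real.sqrt (D : ℝ) : ℝ) : ℂ)) := by
  simp [quadraticLattice, Fintype.linearCombination_apply]

theorem normSq_quadraticLattice (D : ℕ) (v : Fin 2 → ℤ) :
    Complex.normSq (quadraticLattice D v) = ((v 0 ^ 2 + D * v 1 ^ 2 : ℤ) : ℝ) := by
  have hs : Real.sqrt (D : ℝ) ^ 2 = D := Real.sq_sqrt (Nat.cast_nonneg D)
  rw [quadraticLattice_apply, Complex.normSq_apply]
  obtain ⟨h1, h2⟩ := re_im_add_mul_I_sqrt D (v 0 : ℝ) (v 1 : ℝ)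
  push_cast at h1 h2 ⊢
  rw [h1, h2]
  linear_combination (v 1 : ℝ) ^ 2 * hs

/-- The squared norm `v 0 ^ 2 + D * v 1 ^ 2` is an integer. This gap around 0 yields both the
injectivity of `quadraticLattice` and the discreteness of the period group. -/
theorem eq_zero_of_norm_quadraticLattice_lt_one {D : ℕ} (hD : 0 < D) {v : Fin 2 → ℤ}
    (h : ‖quadraticLattice D v‖ < 1) : v = 0 := by
  have h1 : Complex.normSq (quadraticLattice D v) < 1 := by
    rw [Complex.normSq_eq_norm_sq]
    nlinarith [norm_nonneg (quadraticLattice D v)]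
  rw [normSq_quadraticLattice] at h1
  have h2 : v 0 ^ 2 + D * v 1 ^ 2 < 1 := by exact_mod_cast h1
  have hD' : (1 : ℤ) ≤ D := by exact_mod_cast hD
  have h3 : v 1 ^ 2 ≤ D * v 1 ^ 2 := le_mul_of_one_le_left (sq_nonneg _) hD'
  have h4 : v 0 = 0 := by
    have : v 0 ^ 2 = 0 := by linarith [sq_nonneg (v 0), sq_nonneg (v 1), Int.le_of_lt_add_one (b := 0) h2]
    exact pow_eq_zero_iff two_ne_zero |>.mp this
  have h5 : v 1 = 0 := by
    have : v 1 ^ 2 = 0 := by linarith [sq_nonneg (v 0), sq_nonneg (v 1), Int.le_of_lt_add_one (b := 0) h2]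
    exact pow_eq_zero_iff two_ne_zero |>.mp this
  ext i
  fin_cases i
  · exact h4
  · exact h5

theorem quadraticLattice_injective {D : ℕ} (hD : 0 < D) :
    Function.Injective (quadraticLattice D) := by
  rw [← LinearMap.ker_eq_bot, LinearMap.ker_eq_bot']
  exact fun v hv => eq_zero_of_norm_quadraticLattice_lt_one hD (by rw [hv]; simp)

/-- Vectors with coordinates in `ℚ(√-D)` have integral multiples in `ℤ + ℤ√-D`. -/
theorem exists_integral_multiple {A : Type*} [Finite A] {D : ℕ} {w : A → ℂ}
    (hw : ∀ e, w e ∈ imagQuadField D) :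
    ∃ (n : ℤ) (x : A → Fin 2 → ℤ), n ≠ 0 ∧ ∀ e, (n : ℂ) * w e = quadraticLattice D (x e) := by
  choose a b hab using fun e => mem_imagQuadField_iff.mp (hw e)
  obtain ⟨n, hn⟩ := IsLocalization.exist_integer_multiples_of_finite (nonZeroDivisors ℤ)
    (Sum.elim a b)
  choose x hx using fun e => hn (Sum.inl e)
  choose y hy using fun e => hn (Sum.inr e)
  refine ⟨n, fun e => ![x e, y e], nonZeroDivisors.coe_ne_zero n, fun e => ?_⟩
  have h1 : (x e : ℚ) = n * a e := by simpa using hx e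
  have h2 : (y e : ℚ) = n * b e := by simpa using hy e
  have h1' : (x e : ℂ) = n * a e := by exact_mod_cast congrArg (Rat.cast : ℚ → ℂ) h1
  have h2' : (y e : ℂ) = n * b e := by exact_mod_cast congrArg (Rat.cast : ℚ → ℂ) h2
  rw [quadraticLattice_apply, hab]
  simp only [Matrix.cons_val_zero, Matrix.cons_val_one, h1', h2']
  ring

/-- A harmonic isotropic cochain with values in `ℤ + ℤ√-D` has periods of rank two: they contain
nonzero multiples of `1` and of `√-D`. -/
theorem OrientedGraph.IsHarmonic.exists_periods {V A : Type*} [Fintype A] [DecidableEq V]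
    {X : OrientedGraph V A} {D : ℕ} (hD : 0 < D) {x : A → Fin 2 → ℤ} (hx : x ≠ 0)
    (hharm : X.IsHarmonic fun e => quadraticLattice D (x e))
    (hiso : ∑ e, quadraticLattice D (x e) ^ 2 = 0) :
    ∃ (m n : ℤ) (c d : X.H1), m ≠ 0 ∧ n ≠ 0 ∧
      Finsupp.linearCombination ℤ x (c : A →₀ ℤ) = ![m, 0] ∧
      Finsupp.linearCombination ℤ x (d : A →₀ ℤ) = ![0, n] := by
  have hinj := quadraticLattice_injective hD
  -- Injectivity of `quadraticLattice` lets harmonicity be read coordinatewise: each integer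
  -- coordinate of `x` is a cycle.
  have hcycle : ∀ k, Finsupp.equivFunOnFinite.symm (fun e => x e k) ∈ X.H1 := by
    intro k
    rw [mem_H1]
    ext v
    rw [boundary_apply]
    have h1 := (X.isHarmonic_iff _).mp hharm v
    rw [← map_sum, ← map_sum] at h1
    have h2 := congrFun (hinj h1) k
    simp only [Finset.sum_apply] at h2
    simp [h2]
  -- Isotropy, separated into the coefficients of 1 and √-D. The sums occurring here are the periods
  -- of `x` over its own two coordinate cycles, so `m` and `n` are the sums of squares of the
  -- coordinates.
  have hN : (∑ e, x e 0 ^ 2) - D * (∑ e, x e 1 ^ 2) = 0 ∧ 2 * ∑ e, x e 0 * x e 1 = 0 := by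
    have h1 : quadraticLattice D
        ![(∑ e, x e 0 ^ 2) - D * (∑ e, x e 1 ^ 2), 2 * ∑ e, x e 0 * x e 1] = 0 := by
      rw [← hiso, quadraticLattice_apply]
      simp only [Matrix.cons_val_zero, Matrix.cons_val_one, quadraticLattice_apply]
      push_cast
      rw [Finset.mul_sum, Finset.mul_sum, Finset.sum_mul, ← Finset.sum_sub_distrib,
        ← Finset.sum_add_distrib]
      refine Finset.sum_congr rfl fun e _ => ?_
      linear_combination (-(x e 1 : ℂ) ^ 2) * I_mul_sqrt_sq D
    have h2 := hinj (h1.trans (map_zero _).symm)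
    exact ⟨congrFun h2 0, congrFun h2 1⟩
  have hB : ∑ e, x e 0 * x e 1 = 0 := by
    simpa using hN.2
  have hn : ∑ e, x e 1 ^ 2 ≠ 0 := by
    intro h1
    have h0 : ∑ e, x e 0 ^ 2 = 0 := by simpa [h1] using hN.1
    rw [Finset.sum_eq_zero_iff_of_nonneg fun _ _ => sq_nonneg _] at h0 h1
    apply hx
    ext e k
    fin_cases k
    · exact pow_eq_zero_iff two_ne_zero |>.mp (h0 e (Finset.mem_univ e))
    · exact pow_eq_zero_iff two_ne_zero |>.mp (h1 e (Finset.mem_univ e))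
  have hm : ∑ e, x e 0 ^ 2 ≠ 0 := by
    rw [sub_eq_zero.mp hN.1]
    exact mul_ne_zero (by exact_mod_cast hD.ne') hn
  refine ⟨_, _, ⟨_, hcycle 0⟩, ⟨_, hcycle 1⟩, hm, hn, ?_, ?_⟩
  · ext k
    rw [Finsupp.linearCombination_apply, Finsupp.sum_fintype _ _ (by simp)]
    fin_cases k
    · simp [sq]
    · simpa using hB
  · ext k
    rw [Finsupp.linearCombination_apply, Finsupp.sum_fintype _ _ (by simp)]
    fin_cases k
    · simpa [mul_comm] using hB
    · simp [sq]

/-- The voltage of an edge is the period over its projection to H₁, in coordinates of the period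
group. Using `Fin 2 → ℤ` in place of `L` keeps the vertices and edges of the covering in the
universes of `V₀` and `A₀`. -/
theorem exists_isStandardRealization {V₀ : Type u} {A₀ : Type v} [Fintype A₀]
    [DecidableEq V₀] {X₀ : OrientedGraph V₀ A₀} (hX₀ : X₀.Connected) (L : Type w) [AddCommGroup L]
    [Module.Free ℤ L] (hL : Module.finrank ℤ L = 2) {D : ℕ} (hD : 0 < D) {x : A₀ → Fin 2 → ℤ}
    (hx : x ≠ 0) (hharm : X₀.IsHarmonic fun e => quadraticLattice D (x e))
    (hiso : ∑ e, quadraticLattice D (x e) ^ 2 = 0) :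
    ∃ (V : Type u) (A : Type v) (X : TopologicalCrystal X₀ L V A) (Φ : V → ℂ) (ρ : L →+ ℂ),
      X.IsStandardRealization Φ ρ fun e => quadraticLattice D (x e) := by
  have : Module.Finite ℤ L := Module.finite_of_finrank_pos (by omega)
  have hinj := quadraticLattice_injective hD
  obtain ⟨m, n, c, d, hm, hn, hc, hd⟩ := hharm.exists_periods hD hx hiso
  let per : X₀.H1 →ₗ[ℤ] (Fin 2 → ℤ) := (Finsupp.linearCombination ℤ x).comp X₀.H1.subtype
  have hrank : Module.finrank ℤ (LinearMap.range per) = 2 := by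
    apply le_antisymm
    · simpa using Submodule.finrank_le (LinearMap.range per)
    · have hli : LinearIndependent ℤ ![per.rangeRestrict c, per.rangeRestrict d] := by
        rw [LinearIndependent.pair_iff]
        intro s t hst
        have h1 : s • ![m, 0] + t • ![0, n] = 0 := by
          rw [← hc, ← hd]
          exact congrArg Subtype.val hst
        have h2 := congrFun h1 0
        have h3 := congrFun h1 1
        simp [hm, hn] at h2 h3
        exact ⟨h2, h3⟩
      simpa using hli.fintype_card_le_finrank
  let E : LinearMap.range per ≃ₗ[ℤ] (Fin 2 → ℤ) :=
    LinearEquiv.ofFinrankEq _ _ (by rw [hrank]; simp)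
  let ε : L ≃ₗ[ℤ] (Fin 2 → ℤ) := LinearEquiv.ofFinrankEq _ _ (by rw [hL]; simp)
  obtain ⟨π, k, hπ, hπe⟩ := hX₀.exists_retraction
  let U : (A₀ →₀ ℤ) →ₗ[ℤ] (Fin 2 → ℤ) := E.toLinearMap ∘ₗ per.rangeRestrict ∘ₗ π
  let u : A₀ → Fin 2 → ℤ := fun e => U (Finsupp.single e 1)
  have hu : Finsupp.linearCombination ℤ u = U := by
    ext1 e
    ext1
    simp [u]
  have hconn : (X₀.voltageGraph u).Connected := by
    refine OrientedGraph.voltageGraph_connected hX₀ u fun v => ?_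
    obtain ⟨α, hα⟩ := per.surjective_rangeRestrict (E.symm v)
    refine ⟨α, α.2, ?_⟩
    rw [hu]
    change E (per.rangeRestrict (π α)) = v
    rw [hπ, hα, E.apply_symm_apply]
  let ρ' : (Fin 2 → ℤ) →ₗ[ℤ] ℂ :=
    quadraticLattice D ∘ₗ (LinearMap.range per).subtype ∘ₗ E.symm.toLinearMap
  let z : A₀ → ℂ := fun e => quadraticLattice D (x e)
  have hz : ∀ α, quadraticLattice D (Finsupp.linearCombination ℤ x α) =
      Finsupp.linearCombination ℤ z α := fun α => by
    simp only [Finsupp.linearCombination_apply, Finsupp.sum, map_sum, map_smul, z]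
  -- Since `π` moves each edge by a coboundary of `k`, the cochains `ρ' ∘ u` and `z` differ by the
  -- coboundary of `z` integrated along `k`. Adding that potential in `Φ` makes the building cochain
  -- exactly `z`.
  have hρ' : ∀ e, ρ' (u e) = z e - (Finsupp.linearCombination ℤ z (k (X₀.t e)) -
      Finsupp.linearCombination ℤ z (k (X₀.o e))) := by
    intro e
    have h1 : ρ' (u e) = quadraticLattice D
        (Finsupp.linearCombination ℤ x (π (Finsupp.single e 1) : A₀ →₀ ℤ)) := by
      simp only [ρ', u, U, LinearMap.comp_apply, LinearEquiv.coe_coe, LinearEquiv.symm_apply_apply]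
      rfl
    rw [h1, hz, hπe, map_sub, map_sub, Finsupp.linearCombination_single, one_smul]
  let ρ : L →+ ℂ := (ρ' ∘ₗ ε.toLinearMap).toAddMonoidHom
  have hρ : ∀ σ, ρ σ = ρ' (ε σ) := fun _ => rfl
  have hlat : ∀ σ, ∃ v, ρ σ = quadraticLattice D v := fun σ => ⟨_, rfl⟩
  have hper : ∀ α : X₀.H1, quadraticLattice D (per α) ∈ ρ.range := by
    intro α
    refine ⟨ε.symm (E (per.rangeRestrict α)), ?_⟩
    rw [hρ]
    simp [ρ']
  refine ⟨V₀ × (Fin 2 → ℤ), A₀ × (Fin 2 → ℤ), OrientedGraph.voltageCrystal ε.toAddEquiv u hconn,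
    fun p => Finsupp.linearCombination ℤ z (k p.1) + ρ' p.2, ρ, ⟨?_, ?_, ?_, ?_⟩, ?_, hharm, ?_⟩
  · rintro σ ⟨y, v⟩
    change Finsupp.linearCombination ℤ z (k y) + ρ' (v + ε σ) =
      Finsupp.linearCombination ℤ z (k y) + ρ' v + ρ σ
    rw [map_add, hρ, add_assoc]
  · intro σ τ h
    exact ε.injective (E.symm.injective (Subtype.val_injective (hinj h)))
  · refine discreteTopology_of_isOpen_singleton_zero (Metric.isOpen_singleton_iff.mpr
      ⟨1, one_pos, ?_⟩)
    rintro ⟨_, σ, rfl⟩ h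
    obtain ⟨v, hv⟩ := hlat σ
    rw [dist_zero_right] at h
    change ‖ρ σ‖ < 1 at h
    rw [hv] at h
    ext1
    change ρ σ = 0
    rw [hv, eq_zero_of_norm_quadraticLattice_lt_one hD h, map_zero]
  · rw [eq_top_iff]
    rintro y -
    have hs : Real.sqrt (D : ℝ) ≠ 0 := (Real.sqrt_pos.mpr (by exact_mod_cast hD)).ne'
    have hs' : ((Real.sqrt (D : ℝ) : ℝ) : ℂ) ≠ 0 := by exact_mod_cast hs
    have hm' : (m : ℂ) ≠ 0 := by exact_mod_cast hm
    have hn' : (n : ℂ) ≠ 0 := by exact_mod_cast hn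
    have h1 : (m : ℂ) ∈ Submodule.span ℝ (ρ.range : Set ℂ) := by
      refine Submodule.subset_span ?_
      have := hper c
      rw [show per c = ![m, 0] from hc, quadraticLattice_apply] at this
      simpa using this
    have h2 : (n : ℂ) * (Complex.I * ((Real.sqrt (D : ℝ) : ℝ) : ℂ)) ∈
        Submodule.span ℝ (ρ.range : Set ℂ) := by
      refine Submodule.subset_span ?_
      have := hper d
      rw [show per d = ![0, n] from hd, quadraticLattice_apply] at this
      simpa using this
    have h3 : y = (y.re / m) • (m : ℂ) + (y.im / (n * Real.sqrt D)) •
        ((n : ℂ) * (Complex.I * ((Real.sqrt (D : ℝ) : ℝ) : ℂ))) := by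
      conv_lhs => rw [← Complex.re_add_im y]
      rw [Complex.real_smul, Complex.real_smul]
      push_cast
      field_simp
    rw [h3]
    exact add_mem (Submodule.smul_mem _ _ h1) (Submodule.smul_mem _ _ h2)
  · rintro ⟨e, v⟩
    change z e = Finsupp.linearCombination ℤ z (k (X₀.t e)) + ρ' (v + u e) -
      (Finsupp.linearCombination ℤ z (k (X₀.o e)) + ρ' v)
    rw [map_add, hρ']
    ring
  · refine isTightFrame_of_sum_sq_eq_zero (fun h => hx (funext fun e => hinj ?_)) hiso
    rw [Pi.zero_apply, map_zero]
    exact congrFun h e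

theorem mainTheorem5 {V₀ : Type u} {A₀ : Type v} [Finite V₀] [Fintype A₀] [DecidableEq V₀]
    (X₀ : OrientedGraph V₀ A₀) (hX₀ : X₀.Connected)
    (L : Type w) [AddCommGroup L] [Module.Free ℤ L] (hL : Module.finrank ℤ L = 2) :
    (∀ (V : Type u) (A : Type v) (X : TopologicalCrystal X₀ L V A)
      (Φ : V → ℂ) (ρ : L →+ ℂ) (z : A₀ → ℂ), X.IsStandardRealization Φ ρ z →
        ∃ hz : z ≠ 0, Projectivization.mk ℂ z hz ∈ X₀.quadric ∧
          ∀ D : ℕ, Squarefree D →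
            (Projectivization.mk ℂ z hz ∈ rationalPoints A₀ D ↔
              IsSquarefreePart D (X₀.treeNumber * intersectionDet X.vanishingSubgroup))) ∧
    (∀ D : ℕ, Squarefree D → ∀ p ∈ X₀.quadric ∩ rationalPoints A₀ D,
      ∃ (V : Type u) (A : Type v) (X : TopologicalCrystal X₀ L V A)
        (Φ : V → ℂ) (ρ : L →+ ℂ) (z : A₀ → ℂ) (hz : z ≠ 0),
          X.IsStandardRealization Φ ρ z ∧ p = Projectivization.mk ℂ z hz ∧
            IsSquarefreePart D (X₀.treeNumber * intersectionDet X.vanishingSubgroup)) := by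
  refine ⟨fun V A X Φ ρ z h => ⟨h.tight.ne_zero, ⟨z, h.tight.ne_zero, rfl, h.harmonic,
    h.tight.sum_sq_eq_zero⟩, fun D hD => h.mk_mem_rationalPoints_iff hL hX₀ hD⟩, ?_⟩
  rintro D hD p ⟨⟨z, hz, rfl, hharm, hiso⟩, hrat⟩
  obtain ⟨w, hw, hmk, hwK⟩ := id hrat
  obtain ⟨a, ha⟩ := (Projectivization.mk_eq_mk_iff' ℂ w z hw hz).mp hmk.symm
  obtain ⟨n, x, hn, hx⟩ := exists_integral_multiple hwK
  have hxz : (fun e => quadraticLattice D (x e)) = (n * a) • z := by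
    ext e
    rw [← hx, ← ha]
    simp [mul_assoc]
  have hna : (n * a : ℂ) ≠ 0 := by
    refine mul_ne_zero (by exact_mod_cast hn) ?_
    rintro rfl
    exact hw (by rw [← ha, zero_smul])
  have hmk' : ∀ h0 : (fun e => quadraticLattice D (x e)) ≠ 0, Projectivization.mk ℂ z hz =
      Projectivization.mk ℂ (fun e => quadraticLattice D (x e)) h0 := fun h0 => by
    rw [eq_comm, Projectivization.mk_eq_mk_iff']
    exact ⟨_, hxz.symm⟩
  have hharm' : X₀.IsHarmonic fun e => quadraticLattice D (x e) := by
    rw [hxz, OrientedGraph.isHarmonic_iff]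
    intro v
    simp only [Pi.smul_apply, ← Finset.smul_sum, (X₀.isHarmonic_iff z).mp hharm v]
  have hiso' : ∑ e, quadraticLattice D (x e) ^ 2 = 0 := by
    have : ∀ e, quadraticLattice D (x e) = (n * a) * z e := congrFun hxz
    simp only [this, mul_pow, ← Finset.mul_sum, hiso, mul_zero]
  have hx0 : x ≠ 0 := by
    rintro rfl
    have : (n * a) • z = 0 := by
      rw [← hxz]
      ext e
      simp
    exact smul_ne_zero hna hz this
  obtain ⟨V, A, X, Φ, ρ, h⟩ :=
    exists_isStandardRealization hX₀ L hL hD.ne_zero.bot_lt hx0 hharm' hiso'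
  refine ⟨V, A, X, Φ, ρ, _, h.tight.ne_zero, h, hmk' _, ?_⟩
  -- The rescaled cochain represents the given point, so the rationality of that point, fed into the
  -- criterion of the first half, identifies `D`.
  rw [← h.mk_mem_rationalPoints_iff hL hX₀ hD, ← hmk']
  exact hrat
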